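/- Let $K$ be a field, let $n,r$ be integers with $1\le r\le n-1$, and let $P$ be a prime ideal of height $r$ of $\widehat A=K[[X]]=K[[x_1,\dots,x_n]]$ with $x_1\notin P$. By a *change of variables* of $x_2,\dots,x_n$ we mean a finite sequence of steps, starting from $(x_1,\dots,x_n)$, each of which replaces the current variables $(u_1,\dots,u_n)$ by $(w_1,\dots,w_n)$ as follows: for some $k\in\{2,\dots,n\}$, some $S\subseteq\{2,\dots,n\}\setminus\{k\}$ and some integers $e_i\ge 1$, one has $w_i=u_i+u_k^{e_i}$ for $i\in S$ and $w_i=u_i$ for $i\notin S$. In particular $x_1$ is left fixed. Then there exist such a change of variables $x_1\mapsto z_1=x_1,\ x_2\mapsto z_2,\dots,x_n\mapsto z_n$ and a regular sequence $f_1,\dots,f_r$ of $\widehat A$ consisting of elements of $P$ such that, setting $Z_1=\{z_1,\dots,z_{n-r}\}$, $Z_2=\{z_{n-r+1},\dots,z_n\}$, $Z=Z_1\cup Z_2$, for each $1\le i\le r$ we have $$f_i\in K[[Z_1]]\,[z_{n-r+1},\dots,z_{n-i}]\,[z_{n-i+1}],\qquad f_i \text{ monic as a polynomial in } z_{n-i+1},$$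 where the polynomial variables $z_{n-r+1},\dots,z_{n-i}$ are absent for $i=r$. Moreover, with $D:=K[[Z_1]]\,[Z_2]_{(Z)}\subseteq\widehat A$ (the localization of $K[[Z_1]][Z_2]$ at the prime ideal generated by $Z$): 1. $P$ is a minimal prime of the ideal $(f_1,\dots,f_r)\widehat A$. 2. The $(Z_2)$-adic completion of $D$ and the $(f_1,\dots,f_r)$-adic completion of $D$ are both equal to $\widehat A=K[[X]]=K[[Z]]$ (as $D$-algebras). 3. If $P_1:=P\cap D$, then $P_1\widehat A=P$, that is, $P$ is extended from $D$. 4. The canonical map $D/P_1\to \widehat A/P=K[[Z]]/P$ is an isomorphism, and the canonical map $K[[Z_1]]\to D/P_1$ is injective and finite (hence integral). -/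

import Mathlib

open MvPowerSeries

/-- `IsChangeOfVariables K T z`: the tuple `z` of power series in `x_0, …, x_{n-1}` is obtained from
the tuple of variables by a polynomial change of variables involving only the variables with index
in `T`, that is, by a finite sequence of steps of the following type: choose a pivot `k ∈ T`, a set
`S ⊆ T` of indices that does not contain `k`, and exponents `e_i ≥ 1`; replace `z_i` by
`z_i + z_k ^ e_i` for `i ∈ S`, and keep all other `z_i` (in particular `z_k`). -/
inductive IsChangeOfVariables (K : Type*) [Field K] {n : ℕ} (T : Set (Fin n)) :
    (Fin n → MvPowerSeries (Fin n) K) → Prop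
  | refl : IsChangeOfVariables K T X
  | step (z w : Fin n → MvPowerSeries (Fin n) K) (k : Fin n) (S : Set (Fin n)) (e : Fin n → ℕ)
      (hz : IsChangeOfVariables K T z) (hk : k ∈ T) (hS : S ⊆ T) (hkS : k ∉ S)
      (he : ∀ i ∈ S, 1 ≤ e i)
      (hmove : ∀ i ∈ S, w i = z i + z k ^ e i) (hfix : ∀ i, i ∉ S → w i = z i) :
      IsChangeOfVariables K T w

theorem IsChangeOfVariables.constantCoeff_eq_zero {K : Type*} [Field K] {n : ℕ}
    {T : Set (Fin n)} {z : Fin n → MvPowerSeries (Fin n) K} (h : IsChangeOfVariables K T z) :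
    ∀ i, constantCoeff (z i) = 0 := by
  induction h with
  | refl => intro i; simp
  | step z w k S e hz hk hS hkS he hmove hfix ih =>
    intro i
    by_cases hi : i ∈ S
    · rw [hmove i hi, map_add, map_pow, ih i, ih k,
        zero_pow (Nat.one_le_iff_ne_zero.mp (he i hi)), add_zero]
    · rw [hfix i hi, ih i]

section Subrings

variable {K : Type*} [Field K] {n : ℕ} (z : Fin n → MvPowerSeries (Fin n) K)
  (hz : ∀ i, constantCoeff (z i) = 0)

/-- The substitution `g(x_i : i ∈ s) ↦ g(z_i : i ∈ s)` of power series `z_i` without constant term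
into power series in variables indexed by `s`. -/
noncomputable def substHom (s : Set (Fin n)) :
    MvPowerSeries s K →ₐ[K] MvPowerSeries (Fin n) K :=
  substAlgHom (hasSubst_of_constantCoeff_zero (a := fun i : s => z i) fun i => hz i)

/-- The subring `K[[z_i : i ∈ s]]` of `K[[x_0, …, x_{n-1}]]`: all power series in the `z_i`. -/
noncomputable def seriesIn (s : Set (Fin n)) : Subring (MvPowerSeries (Fin n) K) :=
  (substHom z hz s).toRingHom.range

/-- The subring `K[[z_i : i ∈ s]][z_j : j ∈ t]` of `K[[x_0, …, x_{n-1}]]`: all polynomials in the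
`z_j`, `j ∈ t`, with coefficients in `K[[z_i : i ∈ s]]`, i.e. the subring generated by
`K[[z_i : i ∈ s]]` and the `z_j`, `j ∈ t`. -/
noncomputable def polyIn (s t : Set (Fin n)) : Subring (MvPowerSeries (Fin n) K) :=
  Subring.closure (seriesIn z hz s ∪ z '' t)

theorem seriesIn_le_polyIn (s t : Set (Fin n)) : seriesIn z hz s ≤ polyIn z hz s t :=
  fun _ ha => Subring.subset_closure (Or.inl ha)

/-- The ideal of `K[[z_i : i ∈ s]][z_j : j ∈ t]` generated by all `z_i`, `i ∈ s ∪ t`. -/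
noncomputable def varIdeal (s t : Set (Fin n)) : Ideal (polyIn z hz s t) :=
  Ideal.span {a | ∃ i ∈ s ∪ t, (a : MvPowerSeries (Fin n) K) = z i}

theorem mem_span_X_of_constantCoeff_eq_zero {σ : Type*} [Finite σ] (g : MvPowerSeries σ K)
    (hg : constantCoeff g = 0) :
    g ∈ Ideal.span (Set.range (X : σ → MvPowerSeries σ K)) := by
  classical
  have key : ∀ F : Finset σ, ∀ g : MvPowerSeries σ K,
      (∀ m : σ →₀ ℕ, (∀ i ∈ F, m i = 0) → coeff m g = 0) →
      g ∈ Ideal.span (Set.range (X : σ → MvPowerSeries σ K)) := by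
    intro F
    induction F using Finset.induction_on with
    | empty =>
      intro g h
      have : g = 0 := by ext m; simpa using h m (by simp)
      rw [this]; exact zero_mem _
    | insert a F ha ih =>
      intro g h
      let g₂ : MvPowerSeries σ K := fun m => if m a = 0 then coeff m g else 0
      have hg₂ : ∀ m, coeff m g₂ = if m a = 0 then coeff m g else 0 := fun m => rfl
      have h2 : g₂ ∈ Ideal.span (Set.range (X : σ → MvPowerSeries σ K)) := by
        refine ih g₂ fun m hm => ?_
        rw [hg₂]
        split_ifs with h0
        · refine h m fun i hi => ?_
          rcases Finset.mem_insert.mp hi with rfl | hi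
          · exact h0
          · exact hm i hi
        · rfl
      have h1 : (X a : MvPowerSeries σ K) ∣ g - g₂ := by
        rw [X_dvd_iff]
        intro m hm
        rw [map_sub, hg₂, if_pos hm, sub_self]
      have h3 : g - g₂ ∈ Ideal.span (Set.range (X : σ → MvPowerSeries σ K)) :=
        Ideal.mem_of_dvd _ h1 (Ideal.subset_span ⟨a, rfl⟩)
      simpa using add_mem h3 h2
  have := Fintype.ofFinite σ
  refine key Finset.univ g fun m hm => ?_
  have : m = 0 := by ext i; simpa using hm i (Finset.mem_univ i)
  rw [this]; simpa using hg

theorem mem_varIdeal_iff (s t : Set (Fin n)) (a : polyIn z hz s t) :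
    a ∈ varIdeal z hz s t ↔ constantCoeff (a : MvPowerSeries (Fin n) K) = 0 := by
  have hle : ∀ a ∈ varIdeal z hz s t, constantCoeff (a : MvPowerSeries (Fin n) K) = 0 := by
    let c : polyIn z hz s t →+* K := constantCoeff.comp (polyIn z hz s t).subtype
    have h : varIdeal z hz s t ≤ RingHom.ker c := by
      refine Ideal.span_le.mpr ?_
      rintro b ⟨i, -, hb⟩
      change constantCoeff (b : MvPowerSeries (Fin n) K) = 0
      rw [hb, hz i]
    exact fun a ha => h ha
  have hCs : ∀ k : K, C k ∈ seriesIn z hz s := fun k =>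
    ⟨algebraMap K _ k, (substHom z hz s).commutes k⟩
  have hC : ∀ k : K, C k ∈ polyIn z hz s t := fun k => seriesIn_le_polyIn z hz s t (hCs k)
  -- every element is congruent to a constant
  have hconst : ∀ x : MvPowerSeries (Fin n) K, x ∈ polyIn z hz s t →
      ∃ k : K, ∃ d ∈ varIdeal z hz s t, x = C k + (d : MvPowerSeries (Fin n) K) := by
    intro x hx
    refine Subring.closure_induction (p := fun x _ => ∃ k : K, ∃ d ∈ varIdeal z hz s t,
      x = C k + (d : MvPowerSeries (Fin n) K)) ?_ ?_ ?_ ?_ ?_ ?_ hx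
    · rintro x (⟨g, rfl⟩ | ⟨i, hi, rfl⟩)
      · let ψ : MvPowerSeries s K →+* polyIn z hz s t :=
          (Subring.inclusion (seriesIn_le_polyIn z hz s t)).comp
            (substHom z hz s).toRingHom.rangeRestrict
        have hψ : ∀ g, (ψ g : MvPowerSeries (Fin n) K) = substHom z hz s g := fun g => rfl
        have hmap : Ideal.map ψ (Ideal.span (Set.range X)) ≤ varIdeal z hz s t := by
          rw [Ideal.map_span, Ideal.span_le]
          rintro _ ⟨_, ⟨i, rfl⟩, rfl⟩
          refine Ideal.subset_span ⟨i, Or.inl i.2, ?_⟩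
          exact substAlgHom_X (hasSubst_of_constantCoeff_zero fun i : s => hz i) i
        refine ⟨constantCoeff g, ψ (g - C (constantCoeff g)), hmap (Ideal.mem_map_of_mem ψ
          (mem_span_X_of_constantCoeff_eq_zero _ (by simp))), ?_⟩
        have h1 : substHom z hz s (C (constantCoeff g)) = C (constantCoeff g) :=
          (substHom z hz s).commutes (constantCoeff g)
        rw [hψ, map_sub, h1]
        exact (add_sub_cancel _ _).symm
      · exact ⟨0, ⟨z i, Subring.subset_closure (Or.inr ⟨i, hi, rfl⟩)⟩,
          Ideal.subset_span ⟨i, Or.inr hi, rfl⟩, by simp⟩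
    · exact ⟨0, 0, zero_mem _, by simp⟩
    · exact ⟨1, 0, zero_mem _, by simp⟩
    · rintro x y - - ⟨k, d, hd, rfl⟩ ⟨l, d', hd', rfl⟩
      refine ⟨k + l, d + d', add_mem hd hd', ?_⟩
      rw [map_add, Subring.coe_add]; ring
    · rintro x - ⟨k, d, hd, rfl⟩
      refine ⟨-k, -d, neg_mem hd, ?_⟩
      rw [map_neg, Subring.coe_neg]; ring
    · rintro x y - - ⟨k, d, hd, rfl⟩ ⟨l, d', hd', rfl⟩
      refine ⟨k * l, ⟨C k, hC k⟩ * d' + (⟨C l, hC l⟩ + d') * d,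
        add_mem (Ideal.mul_mem_left _ _ hd') (Ideal.mul_mem_left _ _ hd), ?_⟩
      rw [map_mul, Subring.coe_add, Subring.coe_mul, Subring.coe_mul, Subring.coe_add]; ring
  refine ⟨hle a, fun h => ?_⟩
  obtain ⟨k, d, hd, had⟩ := hconst a a.2
  rw [had, map_add, hle d hd, constantCoeff_C, add_zero] at h
  rw [h, map_zero, zero_add] at had
  rwa [Subtype.ext had]

theorem varIdeal_isPrime (s t : Set (Fin n)) : (varIdeal z hz s t).IsPrime where
  ne_top' h := by
    have h1 : (1 : polyIn z hz s t) ∈ varIdeal z hz s t := h ▸ Submodule.mem_top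
    rw [mem_varIdeal_iff] at h1
    simp at h1
  mem_or_mem' {a b} h := by
    simp only [mem_varIdeal_iff, Subring.coe_mul, map_mul, mul_eq_zero] at h ⊢
    exact h

/-- The localization of `K[[z_i : i ∈ s]][z_j : j ∈ t]` at the prime ideal `(z_i : i ∈ s ∪ t)`,
realized inside `K[[x_0, …, x_{n-1}]]` as the subring of all fractions `b / c` with numerator `b`
in `K[[z_i : i ∈ s]][z_j : j ∈ t]` and denominator `c` in that ring, outside the prime ideal. -/
noncomputable def localPolyIn (s t : Set (Fin n)) : Subring (MvPowerSeries (Fin n) K) where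
  carrier := {a | ∃ b c : polyIn z hz s t, c ∉ varIdeal z hz s t ∧
    (c : MvPowerSeries (Fin n) K) * a = b}
  mul_mem' := by
    rintro a a' ⟨b, c, hc, h⟩ ⟨b', c', hc', h'⟩
    refine ⟨b * b', c * c', fun hm => ((varIdeal_isPrime z hz s t).mem_or_mem hm).elim hc hc', ?_⟩
    rw [Subring.coe_mul, Subring.coe_mul, ← h, ← h']; ring
  one_mem' := ⟨1, 1, (Ideal.ne_top_iff_one _).mp (varIdeal_isPrime z hz s t).ne_top, by simp⟩
  add_mem' := by
    rintro a a' ⟨b, c, hc, h⟩ ⟨b', c', hc', h'⟩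
    refine ⟨c' * b + c * b', c * c',
      fun hm => ((varIdeal_isPrime z hz s t).mem_or_mem hm).elim hc hc', ?_⟩
    rw [Subring.coe_add, Subring.coe_mul, Subring.coe_mul, Subring.coe_mul, ← h, ← h']; ring
  zero_mem' := ⟨0, 1, (Ideal.ne_top_iff_one _).mp (varIdeal_isPrime z hz s t).ne_top, by simp⟩
  neg_mem' := by
    rintro a ⟨b, c, hc, h⟩
    exact ⟨-b, c, hc, by rw [Subring.coe_neg, ← h]; ring⟩

theorem seriesIn_le_localPolyIn (s t : Set (Fin n)) : seriesIn z hz s ≤ localPolyIn z hz s t :=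
  fun a ha => ⟨⟨a, seriesIn_le_polyIn z hz s t ha⟩, 1,
    (Ideal.ne_top_iff_one _).mp (varIdeal_isPrime z hz s t).ne_top, by
      simp⟩

end Subrings

/-! The heart is a Noether normalization that never moves `x_1`. Consider all `d ≥ 1` for which some
admissible change of variables makes `K[[X]]/P` finite over `K[[z_1, …, z_d]]`; `d = n` is one, so
take the least. If `P` contained a nonzero series in `z_1, …, z_d`, primality and `x_1 ∉ P` would
allow its powers of `x_1` to be cancelled, leaving `g ∈ P` with a monomial free of `x_1`. A shear
with rapidly growing exponents makes `g` regular in `z_d`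
(`exists_restrictVars_subst_shear_ne_zero`), and Weierstrass division by `g` then eliminates `z_d`,
against minimality (`exists_finite_seriesIn_of_mem`). So `K[[Z_1]]` injects into `K[[X]]/P`, and the
extension is finite.

Each remaining `z_k` now satisfies a monic equation `p_k(z_k) ∈ P` over `K[[Z_1]]`; these elements
are the `f_i`. Each is regular in its own variable and free of the other variables of `Z_2`, so they
form a regular sequence and `n - d ≤ ht P`. Dividing by them one variable at a time gives `K[[X]] =
K[[Z_1]][Z_2] + (f)`. Integrality modulo `(f)` makes `P` minimal over `(f)`
(`mem_minimalPrimes_of_forall_aeval_mem`), so Krull's height theorem gives `ht P ≤ n - d`, whence `d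
= n - r`.

The equality `K[[X]] = D + (f)`, with `(f) ⊆ P`, also yields `P = P_1 K[[X]]` and `D/P_1 =
K[[X]]/P`. Comparing degrees in `Z_2` shows that `K[[X]]` is the `(Z_2)`-adic completion of the
Noetherian local ring `D`. It is therefore faithfully flat over `D`, so powers of `(f)D` are
contracted from `K[[X]]`, which gives the `(f)`-adic completion. -/

namespace MvPowerSeries

/-! ### Filtration by degree in a subset of the variables. -/

section PartialDegree

variable {σ R : Type*} [CommRing R]

/-- The ideal of power series all of whose monomials have degree at least `k` in the variables
with index in `s`. -/
def partialDegIdeal (R : Type*) [CommRing R] (s : Finset σ) (k : ℕ) :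
    Ideal (MvPowerSeries σ R) where
  carrier := {a | ∀ m : σ →₀ ℕ, ∑ i ∈ s, m i < k → coeff m a = 0}
  zero_mem' m _ := by simp
  add_mem' {a b} ha hb m hm := by rw [map_add, ha m hm, hb m hm, add_zero]
  smul_mem' c a ha m hm := by
    classical
    rw [smul_eq_mul, coeff_mul]
    refine Finset.sum_eq_zero fun p hp => ?_
    rw [Finset.HasAntidiagonal.mem_antidiagonal] at hp
    have : ∑ i ∈ s, p.2 i ≤ ∑ i ∈ s, m i :=
      Finset.sum_le_sum fun i _ => by rw [← hp]; simp
    rw [ha p.2 (by omega), mul_zero]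

theorem partialDegIdeal_anti (s : Finset σ) {k l : ℕ} (h : k ≤ l) :
    partialDegIdeal R s l ≤ partialDegIdeal R s k := fun _ ha m hm => ha m (hm.trans_le h)

theorem partialDegIdeal_zero (s : Finset σ) : partialDegIdeal R s 0 = ⊤ := by
  rw [Ideal.eq_top_iff_one]
  intro m hm
  omega

theorem mul_mem_partialDegIdeal {s : Finset σ} {k l : ℕ} {a b : MvPowerSeries σ R}
    (ha : a ∈ partialDegIdeal R s k) (hb : b ∈ partialDegIdeal R s l) :
    a * b ∈ partialDegIdeal R s (k + l) := by
  classical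
  intro m hm
  rw [coeff_mul]
  refine Finset.sum_eq_zero fun p hp => ?_
  rw [Finset.HasAntidiagonal.mem_antidiagonal] at hp
  have : ∑ i ∈ s, p.1 i + ∑ i ∈ s, p.2 i = ∑ i ∈ s, m i := by
    rw [← hp, ← Finset.sum_add_distrib]; simp
  rcases lt_or_ge (∑ i ∈ s, p.1 i) k with h | h
  · rw [ha _ h, zero_mul]
  · rw [hb _ (by omega), mul_zero]

theorem partialDegIdeal_mul_le (s : Finset σ) (k l : ℕ) :
    partialDegIdeal R s k * partialDegIdeal R s l ≤ partialDegIdeal R s (k + l) :=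
  Ideal.mul_le.mpr fun _ ha _ hb => mul_mem_partialDegIdeal ha hb

theorem X_mem_partialDegIdeal_one {s : Finset σ} {i : σ} (hi : i ∈ s) :
    (X i : MvPowerSeries σ R) ∈ partialDegIdeal R s 1 := by
  classical
  intro m hm
  rw [coeff_X, if_neg]
  rintro rfl
  have := Finset.single_le_sum (f := fun j => (Finsupp.single i 1 : σ →₀ ℕ) j)
    (fun _ _ => Nat.zero_le _) hi
  rw [Finsupp.single_eq_same] at this
  omega

theorem eq_zero_of_forall_mem_partialDegIdeal {s : Finset σ} {a : MvPowerSeries σ R}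
    (h : ∀ k, a ∈ partialDegIdeal R s k) : a = 0 := by
  ext m
  exact h _ m (Nat.lt_succ_self _)

theorem span_X_pow_eq_partialDegIdeal (s : Finset σ) (k : ℕ) :
    Ideal.span ((fun i => (X i : MvPowerSeries σ R)) '' s) ^ k = partialDegIdeal R s k := by
  classical
  have h1 : Ideal.span ((fun i => (X i : MvPowerSeries σ R)) '' s) ≤ partialDegIdeal R s 1 := by
    rw [Ideal.span_le]
    rintro _ ⟨i, hi, rfl⟩
    exact X_mem_partialDegIdeal_one hi
  induction k with
  | zero => rw [pow_zero, partialDegIdeal_zero, Ideal.one_eq_top]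
  | succ k ih =>
    refine le_antisymm ?_ fun a ha => ?_
    · rw [pow_succ, ih]
      exact (Ideal.mul_mono_right h1).trans (partialDegIdeal_mul_le s k 1)
    · rcases s.eq_empty_or_nonempty with rfl | ⟨j₀, hj₀⟩
      · have : a = 0 := by ext m; exact ha m (by simp)
        rw [this]; exact zero_mem _
      -- Assign to every monomial of positive `s`-degree one variable of `s` dividing it. Sorting
      -- the monomials of `a` by this choice writes `a` as `∑ c i * X i` with no overlap.
      have hc : ∀ m : σ →₀ ℕ, ∃ j ∈ s, ∑ i ∈ s, m i ≠ 0 → m j ≠ 0 := fun m => by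
        by_cases h : ∑ i ∈ s, m i = 0
        · exact ⟨j₀, hj₀, fun h' => (h' h).elim⟩
        · obtain ⟨j, hj, hne⟩ := Finset.exists_ne_zero_of_sum_ne_zero h
          exact ⟨j, hj, fun _ => hne⟩
      choose j hjs hj using hc
      let c : σ → MvPowerSeries σ R := fun i m =>
        if j (m + Finsupp.single i 1) = i then coeff (m + Finsupp.single i 1) a else 0
      have hcc : ∀ i m, coeff m (c i) =
        if j (m + Finsupp.single i 1) = i then coeff (m + Finsupp.single i 1) a else 0 :=
        fun i m => rfl
      have hsum : a = ∑ i ∈ s, c i * X i := by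
        ext m
        have hX : ∀ i, coeff m (c i * X i) = if j m = i ∧ m i ≠ 0 then coeff m a else 0 := by
          intro i
          by_cases hi : m i = 0
          · rw [if_neg (by simp [hi])]
            have := (X_dvd_iff (s := i)).mp (Dvd.intro_left (c i) rfl : X i ∣ c i * X i)
            exact this m hi
          · have hm : m = (m - Finsupp.single i 1) + Finsupp.single i 1 :=
              (tsub_add_cancel_of_le (by simpa [Nat.one_le_iff_ne_zero] using hi)).symm
            have : coeff m (c i * X i) = coeff (m - Finsupp.single i 1) (c i) := by
              conv_lhs => rw [hm, X, coeff_add_mul_monomial, mul_one]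
            rw [this, hcc, ← hm]
            simp [hi]
        rw [map_sum, Finset.sum_congr rfl fun i _ => hX i]
        by_cases h : ∑ i ∈ s, m i = 0
        · rw [ha m (by omega)]; simp
        · rw [Finset.sum_eq_single (j m)]
          · simp [hj m h]
          · intro b _ hb
            rw [if_neg fun h => hb h.1.symm]
          · exact fun h => (h (hjs m)).elim
      rw [hsum, pow_succ]
      refine Ideal.sum_mem _ fun i hi => Ideal.mul_mem_mul ?_ (Ideal.subset_span ⟨i, hi, rfl⟩)
      rw [ih]
      intro m hm
      rw [hcc]
      split_ifs
      · refine ha _ ?_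
        have : ∑ l ∈ s, (Finsupp.single i 1 : σ →₀ ℕ) l = 1 := by
          rw [Finset.sum_eq_single i] <;> simp_all
        simp only [Finsupp.add_apply, Finset.sum_add_distrib, this]
        omega
      · rfl

/-- The coefficient at `m` is constant from index `∑ i ∈ s, m i + 1` on, so the limit is read off
coefficientwise. -/
theorem exists_sub_mem_partialDegIdeal (s : Finset σ) (f : ℕ → MvPowerSeries σ R)
    (hf : ∀ k, f (k + 1) - f k ∈ partialDegIdeal R s k) :
    ∃ L, ∀ k, f k - L ∈ partialDegIdeal R s k := by
  have hst : ∀ k l m, ∑ i ∈ s, m i < k → k ≤ l → coeff m (f l) = coeff m (f k) := by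
    intro k l m hm hkl
    induction l, hkl using Nat.le_induction with
    | base => rfl
    | succ l hl ih => rw [← ih, ← sub_eq_zero, ← map_sub, hf l m (hm.trans_le hl)]
  let L : MvPowerSeries σ R := fun m => coeff m (f (∑ i ∈ s, m i + 1))
  have hL : ∀ m, coeff m L = coeff m (f (∑ i ∈ s, m i + 1)) := fun m => rfl
  refine ⟨L, fun k m hm => ?_⟩
  rw [map_sub, hL, hst _ k m (Nat.lt_succ_self _) hm, sub_self]

end PartialDegree

/-! ### Adic completeness for ideals generated by series without constant term. -/

section Complete

variable {K : Type*} [Field K]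

/-- Power series without constant term span an ideal for which the power series ring is
precomplete. -/
theorem exists_sub_mem_span_pow {ι σ : Type*} [Finite ι] [Finite σ] (f : ι → MvPowerSeries σ K)
    (hf : ∀ i, constantCoeff (f i) = 0) (u : ℕ → MvPowerSeries σ K)
    (hu : ∀ k, u (k + 1) - u k ∈ Ideal.span (Set.range f) ^ k) :
    ∃ L, ∀ k, u k - L ∈ Ideal.span (Set.range f) ^ k := by
  classical
  have := Fintype.ofFinite ι
  -- Adjoin a new variable for each generator and send it to `f i`. Powers of `(f)` become images of
  -- the degree filtration in the new variables, where limits exist; a Cauchy sequence is lifted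
  -- increment by increment.
  have hs : HasSubst (Sum.elim f X : ι ⊕ σ → MvPowerSeries σ K) :=
    hasSubst_of_constantCoeff_zero (by rintro (i | i) <;> simp [hf])
  have hr : HasSubst (fun i => X (Sum.inr i) : σ → MvPowerSeries (ι ⊕ σ) K) :=
    hasSubst_of_constantCoeff_zero (by simp)
  let ψ := substAlgHom (R := K) hs
  have hψ : Function.Surjective ψ := fun a => ⟨subst (fun i => X (Sum.inr i)) a, by
    rw [substAlgHom_apply, subst_comp_subst_apply hr hs]
    simp only [subst_X hs, Sum.elim_inr]
    exact congr_fun subst_self a⟩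
  let s : Finset (ι ⊕ σ) := Finset.univ.image Sum.inl
  have hmap : ∀ k, Ideal.map ψ (partialDegIdeal K s k) = Ideal.span (Set.range f) ^ k := by
    intro k
    rw [← span_X_pow_eq_partialDegIdeal, Ideal.map_pow, Ideal.map_span]
    congr 2
    ext a
    simp [s, ψ, subst_X hs]
  have hlift : ∀ k, ∃ c ∈ partialDegIdeal K s k, ψ c = u (k + 1) - u k := fun k =>
    (Ideal.mem_map_iff_of_surjective ψ hψ).mp (by rw [hmap]; exact hu k)
  choose c hc hcu using hlift
  obtain ⟨b₀, hb₀⟩ := hψ (u 0)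
  let b : ℕ → MvPowerSeries (ι ⊕ σ) K := fun k => b₀ + ∑ j ∈ Finset.range k, c j
  have hb : ∀ k, ψ (b k) = u k := by
    intro k
    simp only [b, map_add, map_sum, hcu, hb₀, Finset.sum_range_sub]
    ring
  obtain ⟨L, hL⟩ := exists_sub_mem_partialDegIdeal s b fun k => by
    simpa [b, Finset.sum_range_succ] using hc k
  refine ⟨ψ L, fun k => ?_⟩
  rw [← hmap, ← hb, ← map_sub]
  exact Ideal.mem_map_of_mem _ (hL k)

theorem eq_zero_of_forall_mem_span_pow {ι σ : Type*} [Finite σ] (f : ι → MvPowerSeries σ K)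
    (hf : ∀ i, constantCoeff (f i) = 0) {a : MvPowerSeries σ K}
    (ha : ∀ k, a ∈ Ideal.span (Set.range f) ^ k) : a = 0 := by
  classical
  have := Fintype.ofFinite σ
  refine eq_zero_of_forall_mem_partialDegIdeal (s := Finset.univ) fun k => ?_
  rw [← span_X_pow_eq_partialDegIdeal]
  refine Ideal.pow_right_mono (Ideal.span_le.mpr ?_) k (ha k)
  rintro _ ⟨i, rfl⟩
  simpa using mem_span_X_of_constantCoeff_eq_zero (f i) (hf i)

theorem isAdicComplete_span_range {ι σ : Type*} [Finite ι] [Finite σ] (f : ι → MvPowerSeries σ K)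
    (hf : ∀ i, constantCoeff (f i) = 0) :
    IsAdicComplete (Ideal.span (Set.range f)) (MvPowerSeries σ K) where
  haus' a ha := eq_zero_of_forall_mem_span_pow f hf fun k => by
    simpa [SModEq.zero] using ha k
  prec' u hu := by
    obtain ⟨L, hL⟩ := exists_sub_mem_span_pow f hf u fun k => by
      have := (hu (Nat.le_succ k)).symm
      rw [SModEq.sub_mem] at this
      simpa using this
    exact ⟨L, fun k => by rw [SModEq.sub_mem]; simpa using hL k⟩

end Complete

/-! ### Setting variables to zero. -/

section RestrictVars

variable {σ R : Type*} [CommRing R]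

/-- The endomorphism of the power series ring that sets all variables with index outside `s`
to zero. -/
noncomputable def restrictVars (R : Type*) [CommRing R] (s : Set σ) :
    MvPowerSeries σ R →ₐ[R] MvPowerSeries σ R :=
  (rename (Function.Embedding.subtype (· ∈ s))).comp (killCompl (Function.Embedding.subtype (· ∈ s)))

theorem coeff_restrictVars_of_subset {s : Set σ} (a : MvPowerSeries σ R) {m : σ →₀ ℕ}
    (hm : (m.support : Set σ) ⊆ s) : coeff m (restrictVars R s a) = coeff m a := by
  obtain ⟨x, rfl⟩ : m ∈ Set.range (Finsupp.embDomain (Function.Embedding.subtype (· ∈ s))) := by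
    rw [Finsupp.mem_range_embDomain_iff]; simpa using hm
  rw [restrictVars, AlgHom.comp_apply, coeff_embDomain_rename, coeff_killCompl]

theorem coeff_restrictVars_of_not_subset {s : Set σ} (a : MvPowerSeries σ R) {m : σ →₀ ℕ}
    (hm : ¬ (m.support : Set σ) ⊆ s) : coeff m (restrictVars R s a) = 0 := by
  rw [restrictVars, AlgHom.comp_apply]
  refine coeff_rename_eq_zero _ _ fun ⟨x, hx⟩ => hm ?_
  rw [← hx, ← Finsupp.embDomain_eq_mapDomain]
  intro i hi
  simp at hi
  exact hi.1

theorem coeff_restrictVars (s : Set σ) [DecidablePred (fun m : σ →₀ ℕ => (m.support : Set σ) ⊆ s)]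
    (a : MvPowerSeries σ R) (m : σ →₀ ℕ) :
    coeff m (restrictVars R s a) = if (m.support : Set σ) ⊆ s then coeff m a else 0 := by
  split_ifs with h
  · exact coeff_restrictVars_of_subset a h
  · exact coeff_restrictVars_of_not_subset a h

theorem restrictVars_restrictVars (s t : Set σ) (a : MvPowerSeries σ R) :
    restrictVars R s (restrictVars R t a) = restrictVars R (s ∩ t) a := by
  classical
  ext m
  simp only [coeff_restrictVars, Set.subset_inter_iff]
  split_ifs <;> simp_all

theorem restrictVars_X_of_mem {s : Set σ} {i : σ} (hi : i ∈ s) :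
    restrictVars R s (X i) = X i := by
  rw [restrictVars, AlgHom.comp_apply]
  have : (X i : MvPowerSeries σ R) = X (Function.Embedding.subtype (· ∈ s) ⟨i, hi⟩) := rfl
  rw [this, killCompl_X, rename_X]

theorem restrictVars_X_of_notMem {s : Set σ} {i : σ} (hi : i ∉ s) :
    restrictVars R s (X i) = 0 := by
  rw [restrictVars, AlgHom.comp_apply, killCompl_X_eq_zero (by simpa using hi), map_zero]

theorem restrictVars_univ (a : MvPowerSeries σ R) : restrictVars R Set.univ a = a := by
  ext m
  rw [coeff_restrictVars_of_subset a (Set.subset_univ _)]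

end RestrictVars

/-! ### Weierstrass division and its uniqueness. -/

section Division

variable {σ R : Type*} [CommRing R]

/-- Division by `X k ^ e`, omitting all monomials not divisible by `X k ^ e`. -/
noncomputable def shiftVar (k : σ) (e : ℕ) : MvPowerSeries σ R →+ MvPowerSeries σ R where
  toFun a := fun m => coeff (m + Finsupp.single k e) a
  map_zero' := by ext m; exact map_zero (coeff (m + Finsupp.single k e))
  map_add' a b := by ext m; exact map_add (coeff (m + Finsupp.single k e)) a b

theorem coeff_shiftVar (k : σ) (e : ℕ) (a : MvPowerSeries σ R) (m : σ →₀ ℕ) :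
    coeff m (shiftVar k e a) = coeff (m + Finsupp.single k e) a := rfl

/-- The part of a power series of degree less than `e` in the variable `X k`. -/
noncomputable def lowVar (k : σ) (e : ℕ) (a : MvPowerSeries σ R) : MvPowerSeries σ R :=
  fun m => if m k < e then coeff m a else 0

theorem coeff_lowVar (k : σ) (e : ℕ) (a : MvPowerSeries σ R) (m : σ →₀ ℕ) :
    coeff m (lowVar k e a) = if m k < e then coeff m a else 0 := rfl

theorem coeff_mul_X_pow (k : σ) (e : ℕ) (a : MvPowerSeries σ R) (m : σ →₀ ℕ) :
    coeff m (a * X k ^ e) = if e ≤ m k then coeff (m - Finsupp.single k e) a else 0 := by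
  split_ifs with h
  · have hm : m = (m - Finsupp.single k e) + Finsupp.single k e :=
      (tsub_add_cancel_of_le (by simpa using h)).symm
    conv_lhs => rw [hm, X_pow_eq, coeff_add_mul_monomial, mul_one]
  · exact (X_pow_dvd_iff.mp (Dvd.intro_left a rfl)) m (not_le.mp h)

theorem shiftVar_mul_X_pow (k : σ) (e : ℕ) (a : MvPowerSeries σ R) :
    shiftVar k e (a * X k ^ e) = a := by
  ext m
  rw [coeff_shiftVar, coeff_mul_X_pow, if_pos (by simp), add_tsub_cancel_right]

theorem lowVar_add_shiftVar_mul (k : σ) (e : ℕ) (a : MvPowerSeries σ R) :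
    lowVar k e a + shiftVar k e a * X k ^ e = a := by
  ext m
  rw [map_add, coeff_lowVar, coeff_mul_X_pow, coeff_shiftVar]
  by_cases h : m k < e
  · rw [if_pos h, if_neg (not_le.mpr h), add_zero]
  · rw [if_neg h, if_pos (not_lt.mp h), zero_add,
      tsub_add_cancel_of_le (by simpa using not_lt.mp h)]

/-- This is the shape of a Weierstrass remainder: a polynomial in `X k` of degree less than `e`
whose coefficients are free of `X k`. -/
theorem lowVar_eq_sum (k : σ) (e : ℕ) (a : MvPowerSeries σ R) :
    lowVar k e a = ∑ j ∈ Finset.range e, restrictVars R {k}ᶜ (shiftVar k j a) * X k ^ j := by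
  classical
  ext m
  have key : ∀ j, coeff m (restrictVars R {k}ᶜ (shiftVar k j a) * X k ^ j) =
      if m k = j then coeff m a else 0 := by
    intro j
    rw [coeff_mul_X_pow, coeff_restrictVars, coeff_shiftVar]
    have hs : ((m - Finsupp.single k j).support : Set σ) ⊆ {k}ᶜ ↔ m k ≤ j := by
      rw [Set.subset_compl_singleton_iff]; simp [tsub_eq_zero_iff_le]
    rw [hs]
    rcases lt_trichotomy (m k) j with h | h | h
    · rw [if_neg (by omega), if_neg (by omega)]
    · rw [if_pos (by omega), if_pos (by omega), if_pos h,
        tsub_add_cancel_of_le (by simpa using h.ge)]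
    · rw [if_pos (by omega), if_neg (by omega), if_neg (by omega)]
  simp only [map_sum, key, coeff_lowVar, Finset.sum_ite_eq, Finset.mem_range]

theorem shiftVar_sum_restrictVars (k : σ) (e : ℕ) (b : ℕ → MvPowerSeries σ R) :
    shiftVar k e (∑ j ∈ Finset.range e, restrictVars R {k}ᶜ (b j) * X k ^ j) = 0 := by
  ext m
  rw [coeff_shiftVar, map_sum, map_zero]
  refine Finset.sum_eq_zero fun j hj => ?_
  rw [Finset.mem_range] at hj
  rw [coeff_mul_X_pow]
  split_ifs
  · refine coeff_restrictVars_of_not_subset _ ?_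
    rw [Set.subset_compl_singleton_iff]
    simp
    omega
  · rfl

theorem shiftVar_mem_partialDegIdeal {k : σ} {s : Finset σ} (hk : k ∉ s) (e : ℕ) {t : ℕ}
    {a : MvPowerSeries σ R} (ha : a ∈ partialDegIdeal R s t) :
    shiftVar k e a ∈ partialDegIdeal R s t := by
  intro m hm
  rw [coeff_shiftVar]
  refine ha _ (lt_of_eq_of_lt (Finset.sum_congr rfl fun i hi => ?_) hm)
  have : k ≠ i := fun h => hk (h ▸ hi)
  simp [this]

/-- The hypothesis of Weierstrass division: after setting all other variables to zero, `f` is a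
power series in `X k` of order `e`; its leading coefficient is moreover invertible. -/
structure IsRegularInVar (f : MvPowerSeries σ R) (k : σ) (e : ℕ) : Prop where
  coeff_eq_zero : ∀ j < e, coeff (Finsupp.single k j) f = 0
  isUnit : IsUnit (coeff (Finsupp.single k e) f)

theorem IsRegularInVar.exists_inverse {f : MvPowerSeries σ R} {k : σ} {e : ℕ}
    (hf : IsRegularInVar f k e) : ∃ u, shiftVar k e f * u = 1 := by
  have : IsUnit (shiftVar k e f) := by
    rw [isUnit_iff_constantCoeff, ← coeff_zero_eq_constantCoeff_apply, coeff_shiftVar, zero_add]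
    exact hf.isUnit
  exact this.exists_right_inv

variable [Fintype σ] [DecidableEq σ]

/-- A monomial of degree zero in the other variables is a pure power of `X k`, and regularity kills
those below `e`. This gain of one degree drives the contraction argument. -/
theorem IsRegularInVar.lowVar_mem {f : MvPowerSeries σ R} {k : σ} {e : ℕ}
    (hf : IsRegularInVar f k e) : lowVar k e f ∈ partialDegIdeal R (Finset.univ.erase k) 1 := by
  intro m hm
  rw [coeff_lowVar]
  split_ifs with h
  · have hm' : m = Finsupp.single k (m k) := by
      ext i
      by_cases hi : i = k
      · simp [hi]
      · rw [Finsupp.single_eq_of_ne hi]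
        exact Finset.sum_eq_zero_iff.mp (Nat.lt_one_iff.mp hm) i (by simp [hi])
    rw [hm']
    exact hf.coeff_eq_zero _ h
  · rfl

/-- Weierstrass division. -/
theorem IsRegularInVar.exists_eq_sum_add_mul {f : MvPowerSeries σ R} {k : σ} {e : ℕ}
    (hf : IsRegularInVar f k e) (a : MvPowerSeries σ R) :
    ∃ (b : ℕ → MvPowerSeries σ R) (c : MvPowerSeries σ R),
      a = ∑ j ∈ Finset.range e, restrictVars R {k}ᶜ (b j) * X k ^ j + c * f := by
  obtain ⟨u, hu⟩ := hf.exists_inverse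
  -- Write `f = low + v * X k ^ e` with `u` inverse to `v`. A solution of `L = a + T L` gives the
  -- quotient `u * shiftVar k e L` and the remainder `lowVar k e L`. Since `T` raises the degree in
  -- the other variables, iteration converges to such an `L`.
  let T : MvPowerSeries σ R → MvPowerSeries σ R := fun x => -(lowVar k e f * (u * shiftVar k e x))
  have hTsub : ∀ x y, T (x - y) = T x - T y := fun x y => by simp only [T, map_sub]; ring
  have hT : ∀ t x, x ∈ partialDegIdeal R (Finset.univ.erase k) t →
      T x ∈ partialDegIdeal R (Finset.univ.erase k) (t + 1) := fun t x hx => by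
    rw [add_comm]
    exact neg_mem (mul_mem_partialDegIdeal hf.lowVar_mem
      (Ideal.mul_mem_left _ _ (shiftVar_mem_partialDegIdeal (by simp) e hx)))
  let b : ℕ → MvPowerSeries σ R := fun N => Nat.rec 0 (fun _ x => a + T x) N
  have hb : ∀ N, b (N + 1) = a + T (b N) := fun N => rfl
  have hdiff : ∀ N, b (N + 1) - b N ∈ partialDegIdeal R (Finset.univ.erase k) N := by
    intro N
    induction N with
    | zero => rw [partialDegIdeal_zero]; trivial
    | succ N ih =>
      rw [hb (N + 1), hb N, add_sub_add_left_eq_sub, ← hTsub, ← hb]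
      exact hT _ _ ih
  obtain ⟨L, hL⟩ := exists_sub_mem_partialDegIdeal _ b hdiff
  have hfix : L - a - T L = 0 := by
    refine eq_zero_of_forall_mem_partialDegIdeal (s := Finset.univ.erase k) fun N => ?_
    have h1 : L - a - T L = T (b N - L) - (b (N + 1) - L) := by rw [hTsub, hb]; ring
    rw [h1]
    exact partialDegIdeal_anti _ (Nat.le_succ N) (sub_mem (hT _ _ (hL N)) (hL (N + 1)))
  refine ⟨fun j => shiftVar k j L, u * shiftVar k e L, ?_⟩
  rw [← lowVar_eq_sum]
  have h1 := lowVar_add_shiftVar_mul k e f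
  have h2 := lowVar_add_shiftVar_mul k e L
  calc a = L - T L := by linear_combination -hfix
    _ = lowVar k e L + u * shiftVar k e L * (lowVar k e f + shiftVar k e f * X k ^ e) := by
        simp only [T]
        linear_combination -h2 - shiftVar k e L * X k ^ e * hu
    _ = _ := by rw [h1]

/-- Applying `shiftVar` to the equation expresses `q` through itself multiplied by the low part of
`f`, so its degree in the other variables exceeds every bound. -/
theorem IsRegularInVar.eq_zero_of_mul_eq_sum {f : MvPowerSeries σ R} {k : σ} {e : ℕ}
    (hf : IsRegularInVar f k e) {q : MvPowerSeries σ R} {b : ℕ → MvPowerSeries σ R}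
    (h : q * f = ∑ j ∈ Finset.range e, restrictVars R {k}ᶜ (b j) * X k ^ j) : q = 0 := by
  obtain ⟨u, hu⟩ := hf.exists_inverse
  have hq : q = -(u * shiftVar k e (lowVar k e f * q)) := by
    have h1 := shiftVar_sum_restrictVars k e b
    rw [← h] at h1
    nth_rw 1 [← lowVar_add_shiftVar_mul k e f] at h1
    rw [mul_add, map_add, ← mul_assoc, shiftVar_mul_X_pow, mul_comm q] at h1
    linear_combination u * h1 - q * hu
  refine eq_zero_of_forall_mem_partialDegIdeal (s := Finset.univ.erase k) fun N => ?_
  induction N with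
  | zero => rw [partialDegIdeal_zero]; trivial
  | succ N ih =>
    rw [hq, add_comm]
    exact neg_mem (Ideal.mul_mem_left _ _ (shiftVar_mem_partialDegIdeal (by simp) e
      (mul_mem_partialDegIdeal hf.lowVar_mem ih)))

/-- A power series that is regular in `X k` is a nonzerodivisor modulo any family of power series
not involving `X k`. -/
theorem IsRegularInVar.mem_span_of_mul_mem {f : MvPowerSeries σ R} {k : σ} {e : ℕ}
    (hf : IsRegularInVar f k e) {ι : Type*} [Finite ι] {g : ι → MvPowerSeries σ R}
    (hg : ∀ i, restrictVars R {k}ᶜ (g i) = g i) {a : MvPowerSeries σ R}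
    (ha : a * f ∈ Ideal.span (Set.range g)) : a ∈ Ideal.span (Set.range g) := by
  have := Fintype.ofFinite ι
  obtain ⟨c, hc⟩ := (Ideal.mem_span_range_iff_exists_fun).mp ha
  -- Replace each coefficient `c i` by its remainder modulo `f`. As the `g i` are free of `X k`, the
  -- resulting multiple of `f` still has degree less than `e` in `X k`, so uniqueness of division
  -- makes it zero.
  choose b q hbq using fun i => hf.exists_eq_sum_add_mul (c i)
  have h0 : a - ∑ i, q i * g i = 0 := by
    refine hf.eq_zero_of_mul_eq_sum (b := fun j => ∑ i, b i j * g i) ?_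
    have h1 : ∀ j, restrictVars R {k}ᶜ (∑ i, b i j * g i) * X k ^ j =
        ∑ i, restrictVars R {k}ᶜ (b i j) * X k ^ j * g i := fun j => by
      rw [map_sum, Finset.sum_mul]
      refine Finset.sum_congr rfl fun i _ => ?_
      rw [map_mul, hg]; ring
    simp only [h1]
    rw [Finset.sum_comm, sub_mul, ← hc, Finset.sum_mul, ← Finset.sum_sub_distrib]
    refine Finset.sum_congr rfl fun i _ => ?_
    rw [← Finset.sum_mul]
    nth_rw 1 [hbq i]
    ring
  rw [sub_eq_zero.mp h0]
  exact Ideal.sum_mem _ fun i _ => Ideal.mul_mem_left _ _ (Ideal.subset_span ⟨i, rfl⟩)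

/-- Weierstrass division among the power series in the variables with index in `t`. -/
theorem IsRegularInVar.exists_eq_sum_add_mul_restrictVars {f : MvPowerSeries σ R} {k : σ} {e : ℕ}
    (hf : IsRegularInVar f k e) {t : Set σ} (hk : k ∈ t) (hft : restrictVars R t f = f)
    {a : MvPowerSeries σ R} (ha : restrictVars R t a = a) :
    ∃ (b : ℕ → MvPowerSeries σ R) (c : MvPowerSeries σ R),
      a = ∑ j ∈ Finset.range e, restrictVars R (t \ {k}) (b j) * X k ^ j +
        restrictVars R t c * f := by
  obtain ⟨b, c, h⟩ := hf.exists_eq_sum_add_mul a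
  refine ⟨b, c, ?_⟩
  have := congrArg (restrictVars R t) h
  simpa only [ha, map_add, map_sum, map_mul, map_pow, hft, restrictVars_X_of_mem hk,
    restrictVars_restrictVars, ← Set.sdiff_eq] using this

end Division

theorem exists_isRegularInVar {σ K : Type*} [Field K] [Fintype σ] [DecidableEq σ]
    {f : MvPowerSeries σ K} {k : σ} (hf : restrictVars K {k} f ≠ 0) :
    ∃ e, IsRegularInVar f k e := by
  classical
  have h : ∃ e, coeff (Finsupp.single k e) f ≠ 0 := by
    by_contra hcon
    push Not at hcon
    refine hf ?_
    ext m
    rw [coeff_restrictVars, map_zero]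
    split_ifs with hm
    · obtain ⟨e, rfl⟩ := Finsupp.support_subset_singleton'.mp
        (by exact_mod_cast hm : m.support ⊆ {k})
      exact hcon e
    · rfl
  exact ⟨Nat.find h, fun j hj => by simpa using Nat.find_min h hj,
    (Nat.find_spec h).isUnit⟩

instance {σ R : Type*} [CommRing R] [IsDomain R] : IsDomain (MvPowerSeries σ R) :=
  NoZeroDivisors.to_isDomain _

/-- In this form, setting variables to zero can be composed with shears. -/
theorem restrictVars_eq_subst {σ R : Type*} [CommRing R] [Finite σ] (s : Set σ)
    [DecidablePred (· ∈ s)] (a : MvPowerSeries σ R) :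
    restrictVars R s a = subst (fun i => if i ∈ s then X i else 0 : σ → MvPowerSeries σ R) a := by
  classical
  have hs : HasSubst (fun i => if i ∈ s then X i else 0 : σ → MvPowerSeries σ R) :=
    hasSubst_of_constantCoeff_zero fun i => by split_ifs <;> simp
  ext m
  rw [coeff_restrictVars, coeff_subst hs]
  have hprod : ∀ d : σ →₀ ℕ, (d.prod fun i e => (if i ∈ s then X i else 0 : MvPowerSeries σ R) ^ e) =
      if (d.support : Set σ) ⊆ s then monomial d 1 else 0 := by
    intro d
    split_ifs with h
    · rw [monomial_one_eq]
      exact Finset.prod_congr rfl fun i hi => by simp only [if_pos (h hi)]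
    · obtain ⟨i, hi, his⟩ := Set.not_subset.mp h
      refine Finset.prod_eq_zero (i := i) hi ?_
      simp only [if_neg his]
      rw [zero_pow (by simpa using hi)]
  simp only [hprod]
  rw [finsum_eq_single _ m]
  · split_ifs <;> simp
  · intro d hd
    split_ifs
    · rw [coeff_monomial, if_neg hd.symm, smul_zero]
    · simp

/-! ### Elementary changes of variables as automorphisms. -/

section Shear

variable {K : Type*} [Field K] {n : ℕ}

open scoped Classical in
/-- The tuple `X i + ε * X k ^ e i` for `i ∈ S`, and `X i` for `i ∉ S`. -/
noncomputable def shear (ε : K) (k : Fin n) (S : Set (Fin n)) (e : Fin n → ℕ) :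
    Fin n → MvPowerSeries (Fin n) K :=
  fun i => if i ∈ S then X i + C ε * X k ^ e i else X i

theorem hasSubst_shear (ε : K) (k : Fin n) {S : Set (Fin n)} {e : Fin n → ℕ}
    (he : ∀ i ∈ S, 1 ≤ e i) : HasSubst (shear ε k S e) :=
  hasSubst_of_constantCoeff_zero fun i => by
    by_cases h : i ∈ S
    · have := he i h
      simp [shear, h, show e i ≠ 0 by omega]
    · simp [shear, h]

theorem subst_shear_subst_shear (ε : K) {k : Fin n} {S : Set (Fin n)} {e : Fin n → ℕ}
    (he : ∀ i ∈ S, 1 ≤ e i) (hkS : k ∉ S) (a : MvPowerSeries (Fin n) K) :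
    subst (shear (-ε) k S e) (subst (shear ε k S e) a) = a := by
  have h1 := hasSubst_shear ε k he
  have h2 := hasSubst_shear (-ε) k he
  rw [subst_comp_subst_apply h1 h2]
  have : (fun i => subst (shear (-ε) k S e) (shear ε k S e i)) = X := by
    ext1 i
    have hk : shear (-ε) k S e k = X k := by simp [shear, hkS]
    rw [← substAlgHom_apply h2]
    by_cases h : i ∈ S
    · have hi : shear ε k S e i = X i + ε • X k ^ e i := by
        rw [smul_eq_C_mul]; simp [shear, h]
      rw [hi, map_add, map_smul, map_pow, substAlgHom_X, substAlgHom_X, hk, smul_eq_C_mul]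
      simp [shear, h]
    · have hi : shear ε k S e i = X i := by simp [shear, h]
      rw [hi, substAlgHom_X]
      simp [shear, h]
  rw [this, subst_self, id]

/-- The automorphism of the power series ring given by an elementary change of variables. -/
noncomputable def shearEquiv {k : Fin n} {S : Set (Fin n)} {e : Fin n → ℕ}
    (he : ∀ i ∈ S, 1 ≤ e i) (hkS : k ∉ S) :
    MvPowerSeries (Fin n) K ≃ₐ[K] MvPowerSeries (Fin n) K :=
  AlgEquiv.ofAlgHom (substAlgHom (hasSubst_shear 1 k he)) (substAlgHom (hasSubst_shear (-1) k he))
    (by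
      ext1 a
      have := subst_shear_subst_shear (-1 : K) he hkS a
      rw [neg_neg] at this
      simpa using this)
    (by
      ext1 a
      simpa using subst_shear_subst_shear (1 : K) he hkS a)

theorem shearEquiv_apply {k : Fin n} {S : Set (Fin n)} {e : Fin n → ℕ}
    (he : ∀ i ∈ S, 1 ≤ e i) (hkS : k ∉ S) (a : MvPowerSeries (Fin n) K) :
    shearEquiv he hkS a = subst (shear 1 k S e) a := by
  rw [← substAlgHom_apply (hasSubst_shear 1 k he)]; rfl

theorem shearEquiv_symm_apply {k : Fin n} {S : Set (Fin n)} {e : Fin n → ℕ}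
    (he : ∀ i ∈ S, 1 ≤ e i) (hkS : k ∉ S) (a : MvPowerSeries (Fin n) K) :
    (shearEquiv he hkS).symm a = subst (shear (-1) k S e) a := by
  rw [← substAlgHom_apply (hasSubst_shear (-1) k he)]; rfl

end Shear

/-! ### Making a series regular in a chosen variable. -/

section Weights

/-- Comparison of digits in base `B`: the entries of `m` after position `i` contribute less than one
unit of weight `B ^ (k - i)`. Only `m` has to be bounded by `B`; the tail of `d` is merely
nonnegative. -/
theorem sum_weight_lt {n : ℕ} {k : Fin n} {m d : Fin n →₀ ℕ} {B : ℕ} (hB : ∑ i, m i < B)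
    (hm : ∀ i, k < i → m i = 0) {i : Fin n} (hlt : ∀ j < i, m j = d j) (hi : m i < d i) :
    ∑ j, B ^ (k.val - j.val) * m j < ∑ j, B ^ (k.val - j.val) * d j := by
  classical
  have hsplit : ∀ u : Fin n → ℕ,
      ∑ j, u j = ∑ j ∈ Finset.Iio i, u j + (u i + ∑ j ∈ Finset.Ioi i, u j) := by
    intro u
    rw [← Finset.sum_erase_add _ _ (Finset.mem_univ i)]
    have : Finset.univ.erase i = Finset.Iio i ∪ Finset.Ioi i := by
      ext j; simp
    rw [this, Finset.sum_union]
    · ring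
    · exact Finset.disjoint_left.mpr fun j h1 h2 =>
        absurd (Finset.mem_Iio.mp h1) (not_lt.mpr (Finset.mem_Ioi.mp h2).le)
  have htail : (∑ j ∈ Finset.Ioi i, B ^ (k.val - j.val) * m j) < B ^ (k.val - i.val) := by
    have h1 : B * (∑ j ∈ Finset.Ioi i, B ^ (k.val - j.val) * m j) ≤
        B ^ (k.val - i.val) * ∑ j, m j := by
      rw [Finset.mul_sum, Finset.mul_sum]
      refine (Finset.sum_le_sum fun j hj => ?_).trans
        (Finset.sum_le_univ_sum_of_nonneg fun _ => Nat.zero_le _)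
      rcases Nat.eq_zero_or_pos (m j) with h0 | h0
      · simp [h0]
      · have hjk : j ≤ k := not_lt.mp fun h => by have := hm j h; omega
        have hij : i < j := Finset.mem_Ioi.mp hj
        rw [← mul_assoc, ← pow_succ']
        refine Nat.mul_le_mul_right _ (Nat.pow_le_pow_right (by omega) ?_)
        have h1 : j.val ≤ k.val := hjk
        have h2 : i.val < j.val := hij
        omega
    have hpos : 0 < B ^ (k.val - i.val) := pow_pos (by omega) _
    have h2 : B ^ (k.val - i.val) * ∑ j, m j < B ^ (k.val - i.val) * B :=
      Nat.mul_lt_mul_of_pos_left hB hpos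
    rw [mul_comm _ B] at h2
    exact Nat.lt_of_mul_lt_mul_left (h1.trans_lt h2)
  rw [hsplit fun j => B ^ (k.val - j.val) * m j, hsplit fun j => B ^ (k.val - j.val) * d j,
    Finset.sum_congr rfl fun j hj => by rw [hlt j (Finset.mem_Iio.mp hj)]]
  have h3 : B ^ (k.val - i.val) * m i + B ^ (k.val - i.val) ≤ B ^ (k.val - i.val) * d i := by
    rw [← Nat.mul_succ]; exact Nat.mul_le_mul_left _ hi
  omega

variable {K : Type*} [Field K] {n : ℕ}

/-- A power series in `X 0, …, X k` that is not divisible by `X 0` becomes regular in `X k` after a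
suitable elementary change of variables fixing `X 0`. -/
theorem exists_restrictVars_subst_shear_ne_zero {k : Fin n} (hk : k.val ≠ 0)
    {g : MvPowerSeries (Fin n) K}
    (hg : ∃ m : Fin n →₀ ℕ, (m.support : Set (Fin n)) ⊆ {i | i.val ≠ 0 ∧ i ≤ k} ∧ coeff m g ≠ 0) :
    ∃ e : Fin n → ℕ, (∀ i, 1 ≤ e i) ∧
      restrictVars K {k} (subst (shear (-1) k {i | i.val ≠ 0 ∧ i < k} e) g) ≠ 0 := by
  classical
  let T : Set (Fin n) := {i | i.val ≠ 0 ∧ i ≤ k}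
  -- Take the lexicographically least exponent of `g` among those supported in `T`. With weights `B
  -- ^ (k - i)`, where `B` exceeds its total degree, every other such exponent has strictly larger
  -- weight, so its term cannot be cancelled.
  obtain ⟨m, ⟨hmT, hmg⟩, hmin⟩ : ∃ m : Fin n →₀ ℕ,
      ((m.support : Set (Fin n)) ⊆ T ∧ coeff m g ≠ 0) ∧
      ∀ d : Fin n →₀ ℕ, (d.support : Set (Fin n)) ⊆ T → coeff d g ≠ 0 → ¬ toLex d < toLex m := by
    obtain ⟨m₀, h₀⟩ := hg
    have hwf : WellFounded ((· < ·) : Lex (Fin n →₀ ℕ) → Lex (Fin n →₀ ℕ) → Prop) :=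
      wellFounded_lt
    obtain ⟨m, hm, hmin⟩ := hwf.has_min
      {m | ((ofLex m).support : Set (Fin n)) ⊆ T ∧ coeff (ofLex m) g ≠ 0} ⟨toLex m₀, h₀⟩
    exact ⟨ofLex m, hm, fun d h1 h2 => hmin (toLex d) ⟨h1, h2⟩⟩
  let B := ∑ i, m i + 1
  let e : Fin n → ℕ := fun i => B ^ (k.val - i.val)
  have he : ∀ i, 1 ≤ e i := fun i => Nat.one_le_pow _ _ (Nat.succ_pos _)
  refine ⟨e, he, ?_⟩
  have hsh := hasSubst_shear (-1 : K) k (S := {i | i.val ≠ 0 ∧ i < k}) (e := e) fun i _ => he i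
  have hs : HasSubst (fun i => if i ∈ ({k} : Set (Fin n)) then X i else 0 :
      Fin n → MvPowerSeries (Fin n) K) :=
    hasSubst_of_constantCoeff_zero fun i => by split_ifs <;> simp
  have hcomp := hsh.comp hs
  simp only [substAlgHom_apply] at hcomp
  rw [restrictVars_eq_subst, subst_comp_subst_apply hsh hs]
  -- On the `k`-axis, the variables of `T` become `± X k ^ e i` and all others, including `X 0`,
  -- vanish. The pivot fits the formula because `e k = B ^ 0 = 1`.
  have hval : ∀ i, subst (fun i => if i ∈ ({k} : Set (Fin n)) then X i else 0 :
      Fin n → MvPowerSeries (Fin n) K) (shear (-1 : K) k {i | i.val ≠ 0 ∧ i < k} e i) =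
      if i ∈ T then C (if i = k then 1 else -1 : K) * X k ^ e i else 0 := by
    intro i
    rw [← restrictVars_eq_subst ({k} : Set (Fin n))]
    have hXk : restrictVars K ({k} : Set (Fin n)) (X k) = X k := restrictVars_X_of_mem rfl
    have hXi : i ≠ k → restrictVars K ({k} : Set (Fin n)) (X i) = 0 := fun h =>
      restrictVars_X_of_notMem h
    rcases lt_trichotomy i k with h | rfl | h
    · by_cases hi : i.val = 0
      · simp [shear, T, hi, hXi h.ne]
      · have hC : restrictVars K ({k} : Set (Fin n)) (C (-1 : K)) = C (-1) :=
          (restrictVars K ({k} : Set (Fin n))).commutes (-1)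
        have h1 : shear (-1 : K) k {i | i.val ≠ 0 ∧ i < k} e i = X i + C (-1) * X k ^ e i := by
          simp [shear, hi, h]
        rw [h1, map_add, map_mul, map_pow, hXi h.ne, hXk, hC, zero_add, if_pos ⟨hi, h.le⟩,
          if_neg h.ne]
    · have h1 : shear (-1 : K) i {j | j.val ≠ 0 ∧ j < i} e i = X i := by simp [shear]
      rw [h1, hXk, if_pos ⟨hk, le_refl i⟩, if_pos rfl]
      simp [e]
    · have h1 : shear (-1 : K) k {i | i.val ≠ 0 ∧ i < k} e i = X i := by simp [shear, h.le]
      rw [h1, hXi h.ne', if_neg fun hT => absurd h (not_lt.mpr hT.2)]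
  have hprod : ∀ d : Fin n →₀ ℕ, (d.prod fun i l => (subst
      (fun i => if i ∈ ({k} : Set (Fin n)) then X i else 0 : Fin n → MvPowerSeries (Fin n) K)
      (shear (-1 : K) k {i | i.val ≠ 0 ∧ i < k} e i)) ^ l) =
      if (d.support : Set (Fin n)) ⊆ T then
        monomial (Finsupp.single k (∑ i, e i * d i)) (∏ i, (if i = k then 1 else -1 : K) ^ d i)
      else 0 := by
    intro d
    simp only [hval]
    split_ifs with h
    · rw [Finsupp.prod_fintype _ _ (by simp)]
      have : ∀ i, (if i ∈ T then C (if i = k then 1 else -1 : K) * X k ^ e i else 0 :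
          MvPowerSeries (Fin n) K) ^ d i =
          C ((if i = k then 1 else -1 : K) ^ d i) * X k ^ (e i * d i) := by
        intro i
        by_cases hi : i ∈ T
        · rw [if_pos hi, mul_pow, ← map_pow, ← pow_mul]
        · have : d i = 0 := by
            by_contra h0
            exact hi (h (by simpa using h0))
          simp [this]
      simp only [this]
      rw [Finset.prod_mul_distrib, ← map_prod, Finset.prod_pow_eq_pow_sum, X_pow_eq,
        ← smul_eq_C_mul, ← map_smul, smul_eq_mul, mul_one]
    · obtain ⟨i, hi, his⟩ := Set.not_subset.mp h
      refine Finset.prod_eq_zero (i := i) hi ?_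
      simp only [if_neg his]
      rw [zero_pow (by simpa using hi)]
  intro h0
  have h1 := congrArg (coeff (Finsupp.single k (∑ i, e i * m i))) h0
  rw [coeff_subst hcomp, map_zero] at h1
  simp only [hprod] at h1
  rw [finsum_eq_single _ m, if_pos hmT, coeff_monomial_same, smul_eq_mul] at h1
  · refine mul_ne_zero hmg (Finset.prod_ne_zero_iff.mpr fun i _ => pow_ne_zero _ ?_) h1
    split_ifs <;> simp
  · intro d hd
    split_ifs with h
    · by_cases hdg : coeff d g = 0
      · rw [hdg, zero_smul]
      · rw [coeff_monomial, if_neg, smul_zero]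
        have hlt : toLex m < toLex d := lt_of_le_of_ne (not_lt.mp (hmin d h hdg))
          fun h' => hd (toLex.injective h').symm
        obtain ⟨i, hi1, hi2⟩ := hlt
        intro heq
        have := sum_weight_lt (k := k) (B := B) (Nat.lt_succ_self _) (fun j hj => by
          by_contra h0
          exact absurd (hmT (by simpa using h0)).2 (not_le.mpr hj)) hi1 hi2
        exact this.ne (Finsupp.single_injective k heq)
    · simp

end Weights

end MvPowerSeries

/-! ### Transport of the subrings along the automorphism `Φ`. -/

section Coordinates

variable {K : Type*} [Field K] {n : ℕ}

theorem IsChangeOfVariables.eq_X {T : Set (Fin n)} {z : Fin n → MvPowerSeries (Fin n) K}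
    (h : IsChangeOfVariables K T z) {i : Fin n} (hi : i ∉ T) : z i = X i := by
  induction h with
  | refl => rfl
  | step z w k S e hz hk hS hkS he hmove hfix ih => rw [hfix i fun h => hi (hS h), ih]

variable {z : Fin n → MvPowerSeries (Fin n) K} {hz : ∀ i, constantCoeff (z i) = 0}
  {Φ : MvPowerSeries (Fin n) K ≃ₐ[K] MvPowerSeries (Fin n) K}

theorem substHom_eq_comp_rename (hΦ : ∀ a, Φ a = subst z a) (s : Set (Fin n))
    (g : MvPowerSeries s K) :
    substHom z hz s g = Φ (rename (Function.Embedding.subtype (· ∈ s)) g) := by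
  have h1 : HasSubst z := hasSubst_of_constantCoeff_zero hz
  rw [hΦ, rename_eq_subst, subst_comp_subst_apply (HasSubst.X_comp _) h1, substHom,
    substAlgHom_apply]
  congr 1
  ext1 i
  exact (subst_X h1 _).symm

/-- `Φ` sends `X i` to `z i`, so questions about series in the `z i` become questions about which
variables occur in `Φ.symm a`. -/
theorem mem_seriesIn_iff (hΦ : ∀ a, Φ a = subst z a) {s : Set (Fin n)}
    {a : MvPowerSeries (Fin n) K} :
    a ∈ seriesIn z hz s ↔ restrictVars K s (Φ.symm a) = Φ.symm a := by
  constructor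
  · rintro ⟨g, rfl⟩
    have : Φ.symm (substHom z hz s g) = rename (Function.Embedding.subtype (· ∈ s)) g := by
      rw [substHom_eq_comp_rename hΦ, AlgEquiv.symm_apply_apply]
    change restrictVars K s (Φ.symm (substHom z hz s g)) = Φ.symm (substHom z hz s g)
    rw [this, restrictVars, AlgHom.comp_apply, killCompl_rename_app]
  · intro h
    refine ⟨killCompl (Function.Embedding.subtype (· ∈ s)) (Φ.symm a), ?_⟩
    change substHom z hz s _ = a
    rw [substHom_eq_comp_rename hΦ]
    rw [restrictVars, AlgHom.comp_apply] at h
    rw [h, AlgEquiv.apply_symm_apply]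

theorem map_restrictVars_mem_seriesIn (hΦ : ∀ a, Φ a = subst z a) (s : Set (Fin n))
    (a : MvPowerSeries (Fin n) K) : Φ (restrictVars K s a) ∈ seriesIn z hz s := by
  rw [mem_seriesIn_iff hΦ, AlgEquiv.symm_apply_apply, restrictVars_restrictVars, Set.inter_self]

theorem algEquiv_X (hz : ∀ i, constantCoeff (z i) = 0) (hΦ : ∀ a, Φ a = subst z a) (i : Fin n) :
    Φ (X i) = z i := by
  rw [hΦ, subst_X (hasSubst_of_constantCoeff_zero hz)]

theorem coord_mem_seriesIn (z : Fin n → MvPowerSeries (Fin n) K)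
    (hz : ∀ i, constantCoeff (z i) = 0) {s : Set (Fin n)} {i : Fin n} (hi : i ∈ s) :
    z i ∈ seriesIn z hz s :=
  ⟨X ⟨i, hi⟩, substAlgHom_X (hasSubst_of_constantCoeff_zero fun i : s => hz i) ⟨i, hi⟩⟩

theorem seriesIn_mono (hΦ : ∀ a, Φ a = subst z a) {s t : Set (Fin n)} (h : s ⊆ t) :
    seriesIn z hz s ≤ seriesIn z hz t := by
  intro a ha
  rw [mem_seriesIn_iff hΦ] at ha ⊢
  rw [← ha, restrictVars_restrictVars, Set.inter_eq_right.mpr h]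

theorem seriesIn_univ (hΦ : ∀ a, Φ a = subst z a) : seriesIn z hz Set.univ = ⊤ := by
  rw [eq_top_iff]
  intro a _
  rw [mem_seriesIn_iff hΦ, restrictVars_univ]

theorem substHom_univ_injective (hΦ : ∀ a, Φ a = subst z a) :
    Function.Injective (substHom z hz Set.univ) := by
  intro a b h
  rw [substHom_eq_comp_rename hΦ, substHom_eq_comp_rename hΦ] at h
  exact rename_injective _ (Φ.injective h)

theorem constantCoeff_algEquiv (hz : ∀ i, constantCoeff (z i) = 0) (hΦ : ∀ a, Φ a = subst z a)
    (a : MvPowerSeries (Fin n) K) : constantCoeff (Φ a) = constantCoeff a := by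
  have h1 : HasSubst z := hasSubst_of_constantCoeff_zero hz
  have h2 : constantCoeff (Φ (a - C (constantCoeff a))) = 0 := by
    rw [hΦ]
    exact constantCoeff_subst_eq_zero h1 hz (by simp)
  have h3 : Φ (C (constantCoeff a)) = C (constantCoeff a) := Φ.commutes _
  rw [map_sub, map_sub, h3, constantCoeff_C, sub_eq_zero] at h2
  exact h2

end Coordinates

/-- The hypothesis makes `S ⧸ ker φ` generated over `R` by `1, x, …, x ^ (e - 1)`, and `T` is finite
over that quotient. In the descent, `h` is supplied by Weierstrass division. -/
theorem RingHom.Finite.comp_of_forall_eq_sum {R S T : Type*} [CommRing R] [CommRing S] [CommRing T]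
    (i : R →+* S) (φ : S →+* T) (hφ : φ.Finite) (x : S) (e : ℕ)
    (h : ∀ a : S, ∃ b : ℕ → R, φ a = φ (∑ j ∈ Finset.range e, i (b j) * x ^ j)) :
    (φ.comp i).Finite := by
  let ψ : R →+* S ⧸ RingHom.ker φ := (Ideal.Quotient.mk _).comp i
  have hψ : ψ.Finite := by
    algebraize [ψ]
    classical
    refine ⟨⟨(Finset.range e).image fun j => Ideal.Quotient.mk _ (x ^ j), ?_⟩⟩
    rw [eq_top_iff]
    intro y _
    obtain ⟨a, rfl⟩ := Ideal.Quotient.mk_surjective y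
    obtain ⟨b, hb⟩ := h a
    have h1 : Ideal.Quotient.mk (RingHom.ker φ) a =
        ∑ j ∈ Finset.range e, b j • Ideal.Quotient.mk (RingHom.ker φ) (x ^ j) := by
      have h2 : Ideal.Quotient.mk (RingHom.ker φ) a =
          Ideal.Quotient.mk (RingHom.ker φ) (∑ j ∈ Finset.range e, i (b j) * x ^ j) := by
        rw [Ideal.Quotient.eq, RingHom.mem_ker, map_sub, hb, sub_self]
      rw [h2, map_sum]
      refine Finset.sum_congr rfl fun j _ => ?_
      rw [map_mul, Algebra.smul_def]
      rfl
    rw [h1]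
    refine Submodule.sum_mem _ fun j hj => Submodule.smul_mem _ _ (Submodule.subset_span ?_)
    exact Finset.mem_coe.mpr (Finset.mem_image_of_mem _ hj)
  have hk : (RingHom.kerLift φ).Finite :=
    RingHom.Finite.of_comp_finite (f := Ideal.Quotient.mk (RingHom.ker φ)) (by
      have : (RingHom.kerLift φ).comp (Ideal.Quotient.mk (RingHom.ker φ)) = φ := by
        ext a; simp
      rwa [this])
  have : φ.comp i = (RingHom.kerLift φ).comp ψ := by
    ext a; simp [ψ]
  rw [this]
  exact hk.comp hψ

/-! ### Noether normalization by descent on the number of variables. -/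

section Descent

variable {K : Type*} [Field K] {n : ℕ}

/-- Both the pivot and the moved variables lie in `t`, so the shear mixes nothing across the
boundary of `t`. Consequently it leaves the subring of series in the variables of `t` unchanged. -/
theorem restrictVars_subst_shear (ε : K) {k : Fin n} {S t : Set (Fin n)} {e : Fin n → ℕ}
    (he : ∀ i ∈ S, 1 ≤ e i) (hk : k ∈ t) (hS : S ⊆ t) (a : MvPowerSeries (Fin n) K) :
    restrictVars K t (subst (shear ε k S e) a) = subst (shear ε k S e) (restrictVars K t a) := by
  classical
  have hs : HasSubst (fun i => if i ∈ t then X i else 0 : Fin n → MvPowerSeries (Fin n) K) :=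
    hasSubst_of_constantCoeff_zero fun i => by split_ifs <;> simp
  have hsh := hasSubst_shear ε k he
  rw [restrictVars_eq_subst, restrictVars_eq_subst, subst_comp_subst_apply hsh hs,
    subst_comp_subst_apply hs hsh]
  congr 1
  ext1 i
  rw [← restrictVars_eq_subst]
  by_cases hi : i ∈ t
  · rw [if_pos hi, subst_X hsh]
    by_cases hiS : i ∈ S
    · have h1 : shear ε k S e i = X i + ε • X k ^ e i := by
        rw [smul_eq_C_mul]; simp [shear, hiS]
      rw [h1, map_add, map_smul, map_pow, restrictVars_X_of_mem hi, restrictVars_X_of_mem hk]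
    · have h1 : shear ε k S e i = X i := by simp [shear, hiS]
      rw [h1, restrictVars_X_of_mem hi]
  · have h1 : shear ε k S e i = X i := by
      have : i ∉ S := fun h => hi (hS h)
      simp [shear, this]
    rw [if_neg hi, h1, restrictVars_X_of_notMem hi, ← substAlgHom_apply hsh, map_zero]

theorem shearEquiv_trans_apply {k : Fin n} {S : Set (Fin n)} {e : Fin n → ℕ}
    (he : ∀ i ∈ S, 1 ≤ e i) (hkS : k ∉ S) {z w : Fin n → MvPowerSeries (Fin n) K}
    (hz : ∀ i, constantCoeff (z i) = 0)
    {Φ : MvPowerSeries (Fin n) K ≃ₐ[K] MvPowerSeries (Fin n) K} (hΦ : ∀ a, Φ a = subst z a)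
    (hmove : ∀ i ∈ S, w i = z i + z k ^ e i) (hfix : ∀ i, i ∉ S → w i = z i)
    (a : MvPowerSeries (Fin n) K) : (shearEquiv he hkS).trans Φ a = subst w a := by
  have hzs : HasSubst z := hasSubst_of_constantCoeff_zero hz
  rw [AlgEquiv.trans_apply, hΦ, shearEquiv_apply,
    subst_comp_subst_apply (hasSubst_shear 1 k he) hzs]
  congr 1
  ext1 i
  rw [← substAlgHom_apply hzs]
  by_cases h : i ∈ S
  · have hi : shear 1 k S e i = (X i + X k ^ e i : MvPowerSeries (Fin n) K) := by simp [shear, h]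
    rw [hi, map_add, map_pow, substAlgHom_X, substAlgHom_X, hmove i h]
  · have hi : shear 1 k S e i = (X i : MvPowerSeries (Fin n) K) := by simp [shear, h]
    rw [hi, substAlgHom_X, hfix i h]

theorem IsChangeOfVariables.exists_algEquiv {T : Set (Fin n)}
    {z : Fin n → MvPowerSeries (Fin n) K} (h : IsChangeOfVariables K T z) :
    ∃ Φ : MvPowerSeries (Fin n) K ≃ₐ[K] MvPowerSeries (Fin n) K, ∀ a, Φ a = subst z a := by
  induction h with
  | refl => exact ⟨AlgEquiv.refl, fun a => by rw [subst_self]; rfl⟩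
  | step z w k S e hz hk hS hkS he hmove hfix ih =>
    obtain ⟨Φ, hΦ⟩ := ih
    exact ⟨(shearEquiv he hkS).trans Φ,
      shearEquiv_trans_apply he hkS hz.constantCoeff_eq_zero hΦ hmove hfix⟩

variable {z : Fin n → MvPowerSeries (Fin n) K} {hz : ∀ i, constantCoeff (z i) = 0}
  {Φ : MvPowerSeries (Fin n) K ≃ₐ[K] MvPowerSeries (Fin n) K}

/-- Weierstrass division in the coordinates `z`. -/
theorem exists_eq_sum_add_mul_of_mem_seriesIn (hΦ : ∀ a, Φ a = subst z a) {t : Set (Fin n)}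
    {k : Fin n} (hk : k ∈ t) {f : MvPowerSeries (Fin n) K} (hf : f ∈ seriesIn z hz t)
    (hfk : restrictVars K {k} (Φ.symm f) ≠ 0) :
    ∃ e, ∀ a ∈ seriesIn z hz t, ∃ b : ℕ → MvPowerSeries (Fin n) K,
      (∀ j, b j ∈ seriesIn z hz (t \ {k})) ∧ ∃ c ∈ seriesIn z hz t,
        a = ∑ j ∈ Finset.range e, b j * z k ^ j + c * f := by
  obtain ⟨e, he⟩ := exists_isRegularInVar hfk
  refine ⟨e, fun a ha => ?_⟩
  rw [mem_seriesIn_iff hΦ] at hf ha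
  obtain ⟨b, c, h⟩ := he.exists_eq_sum_add_mul_restrictVars hk hf ha
  refine ⟨fun j => Φ (restrictVars K (t \ {k}) (b j)), fun j => map_restrictVars_mem_seriesIn hΦ _ _,
    Φ (restrictVars K t c), map_restrictVars_mem_seriesIn hΦ _ _, ?_⟩
  have := congrArg Φ h
  simpa only [AlgEquiv.apply_symm_apply, map_add, map_sum, map_mul, map_pow, algEquiv_X hz hΦ]
    using this

/-- Split off the largest power of `X i₀` from `Φ.symm f`; since `P` is prime and misses `z i₀`, the
cofactor stays in `P`. -/
theorem exists_mem_not_X_dvd (hΦ : ∀ a, Φ a = subst z a) {t : Set (Fin n)} {i₀ : Fin n}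
    (hi₀ : i₀ ∈ t) {P : Ideal (MvPowerSeries (Fin n) K)} [P.IsPrime] (hP : z i₀ ∉ P)
    {f : MvPowerSeries (Fin n) K} (hf : f ∈ seriesIn z hz t) (hfP : f ∈ P) (hf0 : f ≠ 0) :
    ∃ g, restrictVars K t g = g ∧ Φ g ∈ P ∧ ¬ X i₀ ∣ g := by
  have hX : (X i₀ : MvPowerSeries (Fin n) K) ≠ 0 := fun h => by
    have := congrArg (coeff (Finsupp.single i₀ 1)) h
    simp at this
  have hfm : FiniteMultiplicity (X i₀) (Φ.symm f) :=
    FiniteMultiplicity.of_not_isUnit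
      (by rw [isUnit_iff_constantCoeff]; simp) (by simpa using hf0)
  obtain ⟨g, hg, hdvd⟩ := hfm.exists_eq_pow_mul_and_not_dvd
  refine ⟨g, ?_, ?_, hdvd⟩
  · rw [mem_seriesIn_iff hΦ, hg, map_mul, map_pow, restrictVars_X_of_mem hi₀] at hf
    exact mul_left_cancel₀ (pow_ne_zero _ hX) hf
  · have h1 : z i₀ ^ multiplicity (X i₀) (Φ.symm f) * Φ g = f := by
      rw [← algEquiv_X hz hΦ, ← map_pow, ← map_mul, ← hg, AlgEquiv.apply_symm_apply]
    rw [← h1] at hfP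
    exact (Ideal.IsPrime.mem_or_mem ‹_› hfP).resolve_left
      fun h => hP (Ideal.IsPrime.mem_of_pow_mem ‹_› _ h)

/-- If `K⟦z 0, …, z d⟧` does not inject into `K⟦X⟧ ⧸ P`, then after a further change of variables one
variable fewer suffices for `K⟦X⟧ ⧸ P` to be finite. -/
theorem exists_finite_seriesIn_of_mem (P : Ideal (MvPowerSeries (Fin n) K)) [P.IsPrime] (hn : 0 < n)
    (hx : (X ⟨0, hn⟩ : MvPowerSeries (Fin n) K) ∉ P)
    (hcv : IsChangeOfVariables K {i : Fin n | i.val ≠ 0} z) {d : ℕ} (hd : d < n)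
    (hfin : ((Ideal.Quotient.mk P).comp
      (seriesIn z hcv.constantCoeff_eq_zero {i | i.val < d + 1}).subtype).Finite)
    {f : MvPowerSeries (Fin n) K}
    (hf : f ∈ seriesIn z hcv.constantCoeff_eq_zero {i | i.val < d + 1}) (hfP : f ∈ P)
    (hf0 : f ≠ 0) :
    1 ≤ d ∧ ∃ (w : Fin n → MvPowerSeries (Fin n) K)
      (hcw : IsChangeOfVariables K {i : Fin n | i.val ≠ 0} w),
      ((Ideal.Quotient.mk P).comp
        (seriesIn w hcw.constantCoeff_eq_zero {i | i.val < d}).subtype).Finite := by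
  classical
  obtain ⟨Φ, hΦ⟩ := hcv.exists_algEquiv
  have hz := hcv.constantCoeff_eq_zero
  let k : Fin n := ⟨d, hd⟩
  let t : Set (Fin n) := {i | i.val < d + 1}
  have hz0 : z ⟨0, hn⟩ ∉ P := by rwa [hcv.eq_X (by simp)]
  obtain ⟨g, hgt, hgP, hdvd⟩ := exists_mem_not_X_dvd hΦ (t := t) (i₀ := ⟨0, hn⟩)
    (Nat.succ_pos d) hz0 hf hfP hf0
  rw [X_dvd_iff] at hdvd
  push Not at hdvd
  obtain ⟨m, hm0, hmg⟩ := hdvd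
  have hmt : (m.support : Set (Fin n)) ⊆ {i | i.val ≠ 0 ∧ i ≤ k} := by
    intro i hi
    refine ⟨fun h0 => ?_, ?_⟩
    · have : i = ⟨0, hn⟩ := Fin.ext h0
      rw [this] at hi
      simp [hm0] at hi
    · have hsub : (m.support : Set (Fin n)) ⊆ t := by
        by_contra hcon
        exact hmg (by rw [← hgt, coeff_restrictVars_of_not_subset g hcon])
      exact Nat.lt_succ_iff.mp (hsub hi)
  -- For `d = 0` only the variable `X 0` is available, and `g`, not being divisible by it, would be
  -- a unit whose image lies in `P`.
  have hd1 : 1 ≤ d := by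
    by_contra hcon
    have hd0 : d = 0 := by omega
    have hm : m = 0 := by
      rw [← Finsupp.support_eq_empty, Finset.eq_empty_iff_forall_notMem]
      intro i hi
      have h1 := hmt hi
      have h2 : i.val ≤ d := h1.2
      exact h1.1 (by omega)
    rw [hm, coeff_zero_eq_constantCoeff_apply] at hmg
    have hu : IsUnit g := isUnit_iff_constantCoeff.mpr hmg.isUnit
    exact Ideal.IsPrime.ne_top ‹_› (Ideal.eq_top_of_isUnit_mem _ hgP (hu.map Φ))
  refine ⟨hd1, ?_⟩
  obtain ⟨e, he, hne⟩ := exists_restrictVars_subst_shear_ne_zero (k := k)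
    (show d ≠ 0 by omega) ⟨m, hmt, hmg⟩
  let S : Set (Fin n) := {i | i.val ≠ 0 ∧ i < k}
  have hkS : k ∉ S := fun h => lt_irrefl k h.2
  have heS : ∀ i ∈ S, 1 ≤ e i := fun i _ => he i
  let w : Fin n → MvPowerSeries (Fin n) K := fun i => if i ∈ S then z i + z k ^ e i else z i
  have hmove : ∀ i ∈ S, w i = z i + z k ^ e i := fun i hi => if_pos hi
  have hfix : ∀ i, i ∉ S → w i = z i := fun i hi => if_neg hi
  have hcw : IsChangeOfVariables K {i : Fin n | i.val ≠ 0} w :=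
    .step z w k S e hcv (show d ≠ 0 by omega) (fun i hi => hi.1) hkS heS hmove hfix
  refine ⟨w, hcw, ?_⟩
  have hw := hcw.constantCoeff_eq_zero
  let Ψ := (shearEquiv heS hkS).trans Φ
  have hΨ : ∀ a, Ψ a = subst w a := shearEquiv_trans_apply heS hkS hz hΦ hmove hfix
  -- Expressing a series in the new coordinates applies the inverse shear, which is why regularity
  -- was arranged for `shear (-1)`.
  have hΨs : ∀ a, Ψ.symm a = subst (shear (-1) k S e) (Φ.symm a) := fun a => by
    rw [← shearEquiv_symm_apply heS hkS]; rfl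
  have hSt : S ⊆ t := fun i hi => by
    have : i.val < d := hi.2
    exact this.trans (Nat.lt_succ_self d)
  have hkt : k ∈ t := Nat.lt_succ_self d
  have heq : seriesIn z hz t = seriesIn w hw t := by
    ext a
    rw [mem_seriesIn_iff hΦ, mem_seriesIn_iff hΨ, hΨs, restrictVars_subst_shear _ heS hkt hSt,
      ← shearEquiv_symm_apply heS hkS, ← shearEquiv_symm_apply heS hkS,
      (shearEquiv heS hkS).symm.injective.eq_iff]
  have hfw : Φ g ∈ seriesIn w hw t := by
    rw [← heq, mem_seriesIn_iff hΦ, AlgEquiv.symm_apply_apply, hgt]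
  obtain ⟨N, hN⟩ := exists_eq_sum_add_mul_of_mem_seriesIn hΨ hkt hfw
    (by rw [hΨs, AlgEquiv.symm_apply_apply]; exact hne)
  have hst : t \ {k} = {i | i.val < d} := by
    ext i
    simp only [t, Set.mem_sdiff, Set.mem_ofPred_eq, Set.mem_singleton_iff, k, Fin.ext_iff]
    omega
  rw [hst] at hN
  change ((Ideal.Quotient.mk P).comp (seriesIn z hz t).subtype).Finite at hfin
  rw [heq] at hfin
  have hle : seriesIn w hw {i | i.val < d} ≤ seriesIn w hw t :=
    seriesIn_mono hΨ fun i hi => Nat.lt_succ_of_lt hi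
  have hzk : w k ∈ seriesIn w hw t := coord_mem_seriesIn w hw hkt
  have := RingHom.Finite.comp_of_forall_eq_sum (Subring.inclusion hle) _ hfin ⟨w k, hzk⟩ N
    fun a => by
      obtain ⟨b, hb, c, hc, h⟩ := hN a a.2
      refine ⟨fun j => ⟨b j, hb j⟩, ?_⟩
      simp only [RingHom.comp_apply]
      rw [Ideal.Quotient.eq]
      have h1 : (seriesIn w hw t).subtype (∑ j ∈ Finset.range N,
          Subring.inclusion hle ⟨b j, hb j⟩ * ⟨w k, hzk⟩ ^ j) =
          ∑ j ∈ Finset.range N, b j * w k ^ j := by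
        rw [map_sum]; rfl
      rw [h1, Subring.subtype_apply, h, add_sub_cancel_left]
      exact Ideal.mul_mem_left _ _ hgP
  exact this

/-- Noether normalization for `K⟦X⟧ ⧸ P` by an elementary change of variables fixing a variable
that does not belong to `P`. -/
theorem exists_noether_normalization (P : Ideal (MvPowerSeries (Fin n) K)) [P.IsPrime] (hn : 0 < n)
    (hx : (X ⟨0, hn⟩ : MvPowerSeries (Fin n) K) ∉ P) :
    ∃ d ≤ n, ∃ (z : Fin n → MvPowerSeries (Fin n) K)
      (hcv : IsChangeOfVariables K {i : Fin n | i.val ≠ 0} z),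
      ((Ideal.Quotient.mk P).comp
        (seriesIn z hcv.constantCoeff_eq_zero {i | i.val < d}).subtype).Finite ∧
      ∀ f ∈ seriesIn z hcv.constantCoeff_eq_zero {i | i.val < d}, f ∈ P → f = 0 := by
  classical
  -- The clause `1 ≤ d` allows the least value to be written as `d + 1`; the descent step supplies
  -- it again for the smaller value.
  let Q : ℕ → Prop := fun d => 1 ≤ d ∧ d ≤ n ∧ ∃ (z : Fin n → MvPowerSeries (Fin n) K)
      (hcv : IsChangeOfVariables K {i : Fin n | i.val ≠ 0} z),
      ((Ideal.Quotient.mk P).comp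
        (seriesIn z hcv.constantCoeff_eq_zero {i | i.val < d}).subtype).Finite
  have hQ : ∃ d, Q d := by
    refine ⟨n, hn, le_rfl, X, .refl, RingHom.Finite.of_surjective _ ?_⟩
    refine Ideal.Quotient.mk_surjective.comp fun a => ⟨⟨a, ?_⟩, rfl⟩
    have h1 : {i : Fin n | i.val < n} = Set.univ := by ext i; simp
    rw [h1, seriesIn_univ (Φ := AlgEquiv.refl) fun a => by rw [subst_self]; rfl]
    trivial
  obtain ⟨h1, hdn, z, hcv, hfin⟩ := Nat.find_spec hQ
  refine ⟨Nat.find hQ, hdn, z, hcv, hfin, fun f hf hfP => ?_⟩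
  by_contra hf0
  obtain ⟨d, hd⟩ : ∃ d, Nat.find hQ = d + 1 := ⟨Nat.find hQ - 1, by omega⟩
  rw [hd] at hfin hf
  obtain ⟨hd1, w, hcw, hw⟩ := exists_finite_seriesIn_of_mem P hn hx hcv (by omega) hfin hf hfP hf0
  exact Nat.find_min hQ (m := d) (by omega) ⟨hd1, by omega, w, hcw, hw⟩

end Descent

/-! ### Regular sequences and height. -/

section RegularSequence

open RingTheory.Sequence

theorem isRegular_ofFn_of_forall_mem {R : Type*} [CommRing R] {r : ℕ} (f : Fin r → R)
    (hne : Ideal.span (Set.range f) ≠ ⊤)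
    (h : ∀ (i : Fin r) (a : R), a * f i ∈ Ideal.span (Set.range fun j : {j // j < i} => f j) →
      a ∈ Ideal.span (Set.range fun j : {j // j < i} => f j)) :
    IsRegular R (List.ofFn f) where
  regular_mod_prev i hi := by
    have hir : i < r := by simpa using hi
    have hlist : Ideal.ofList ((List.ofFn f).take i) =
        Ideal.span (Set.range fun j : {j : Fin r // j < ⟨i, hir⟩} => f j) := by
      rw [Ideal.ofList]
      congr 1
      ext x
      simp only [List.mem_take_iff_getElem, List.getElem_ofFn, List.length_ofFn, Set.mem_range,
        Subtype.exists]
      constructor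
      · rintro ⟨j, hj, rfl⟩
        exact ⟨⟨j, by omega⟩, Fin.mk_lt_mk.mpr (by omega), rfl⟩
      · rintro ⟨j, hj, rfl⟩
        have : j.val < i := hj
        exact ⟨j, by omega, rfl⟩
    rw [isSMulRegular_quotient_iff_mem_of_smul_mem, hlist]
    intro x hx
    simp only [smul_eq_mul, Ideal.mul_top, List.getElem_ofFn] at hx ⊢
    exact h ⟨i, hir⟩ x (by rwa [mul_comm])
  top_ne_smul := by
    rw [smul_eq_mul, Ideal.mul_top, Ideal.ofList]
    intro h
    refine hne ?_
    rw [h]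
    congr 1
    ext x
    simp

/-- After localizing at `P`, dividing by the sequence lowers the Krull dimension by exactly its
length. The quotient is nonzero, so its dimension is nonnegative. -/
theorem le_height_of_isRegular {R : Type*} [CommRing R] [IsNoetherianRing R] (P : Ideal R)
    [P.IsPrime] {rs : List R} (hrs : IsRegular R rs) (hP : ∀ x ∈ rs, x ∈ P) :
    (rs.length : ℕ∞) ≤ P.height := by
  have hreg := hrs.toIsWeaklyRegular.isRegular_of_isLocalization_of_mem
    (S := Localization.AtPrime P) P hP
  have h1 := ringKrullDim_add_length_eq_ringKrullDim_of_isRegular _ hreg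
  have : Nontrivial (Localization.AtPrime P ⧸
      Ideal.ofList (rs.map (algebraMap R (Localization.AtPrime P)))) := by
    rw [Ideal.Quotient.nontrivial_iff]
    intro h
    refine hreg.top_ne_smul ?_
    rw [h, smul_eq_mul, Ideal.mul_top]
  have h2 := ringKrullDim_nonneg_of_nontrivial (R := Localization.AtPrime P ⧸
      Ideal.ofList (rs.map (algebraMap R (Localization.AtPrime P))))
  rw [IsLocalization.AtPrime.ringKrullDim_eq_height P (Localization.AtPrime P),
    List.length_map] at h1
  have h3 : ((rs.length : ℕ∞) : WithBot ℕ∞) ≤ (P.height : WithBot ℕ∞) := by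
    rw [← h1]
    exact le_add_of_nonneg_left h2
  exact_mod_cast h3

end RegularSequence

/-! ### Monic equations for the remaining coordinates. -/

section Equations

variable {K : Type*} [Field K] {n : ℕ}

theorem aeval_X_ne_zero_of_monic {q : Polynomial K} (hq : q.Monic) (k : Fin n) :
    Polynomial.aeval (X k : MvPowerSeries (Fin n) K) q ≠ 0 := by
  classical
  intro h
  have h1 := congrArg (coeff (Finsupp.single k q.natDegree)) h
  rw [Polynomial.aeval_eq_sum_range, map_sum, Finset.sum_eq_single q.natDegree] at h1
  · rw [map_smul, coeff_X_pow, if_pos rfl, hq.coeff_natDegree] at h1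
    simp at h1
  · intro j _ hj
    rw [map_smul, coeff_X_pow, if_neg fun h' => hj (Finsupp.single_injective k h').symm, smul_zero]
  · simp

variable {z : Fin n → MvPowerSeries (Fin n) K} {hz : ∀ i, constantCoeff (z i) = 0}
  {Φ : MvPowerSeries (Fin n) K ≃ₐ[K] MvPowerSeries (Fin n) K}

theorem aeval_coord_mem_seriesIn (hΦ : ∀ a, Φ a = subst z a) {s : Set (Fin n)} (k : Fin n)
    (p : Polynomial (seriesIn z hz s)) :
    Polynomial.aeval (z k) p ∈ seriesIn z hz (insert k s) := by
  rw [Polynomial.aeval_eq_sum_range]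
  refine sum_mem fun j _ => ?_
  rw [Algebra.smul_def]
  exact mul_mem (seriesIn_mono hΦ (Set.subset_insert k s) (p.coeff j).2)
    (pow_mem (coord_mem_seriesIn z hz (Set.mem_insert k s)) j)

theorem restrictVars_empty (a : MvPowerSeries (Fin n) K) :
    restrictVars K ∅ a = C (constantCoeff a) := by
  classical
  ext m
  rw [coeff_restrictVars, coeff_C]
  simp only [Set.subset_empty_iff, Finset.coe_eq_empty, Finsupp.support_eq_empty]
  split_ifs with h
  · rw [h, coeff_zero_eq_constantCoeff_apply]
  · rfl

/-- Setting the other coordinates to zero turns the coefficients of `p` into constants, leaving a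
monic polynomial over `K` in `X k`. Thus Weierstrass division by these equations is available. -/
theorem restrictVars_aeval_coord_ne_zero (hΦ : ∀ a, Φ a = subst z a) {s : Set (Fin n)}
    {k : Fin n} (hk : k ∉ s) {p : Polynomial (seriesIn z hz s)} (hp : p.Monic) :
    restrictVars K {k} (Φ.symm (Polynomial.aeval (z k) p)) ≠ 0 := by
  let χ : MvPowerSeries (Fin n) K →+* MvPowerSeries (Fin n) K :=
    (restrictVars K {k}).toRingHom.comp Φ.symm.toRingEquiv.toRingHom
  let ε : seriesIn z hz s →+* K := constantCoeff.comp (seriesIn z hz s).subtype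
  have hχ : ∀ a : seriesIn z hz s, χ a = C (ε a) := by
    intro a
    have h1 := (mem_seriesIn_iff hΦ).mp a.2
    change restrictVars K {k} (Φ.symm a) = C (constantCoeff (a : MvPowerSeries (Fin n) K))
    rw [← h1, restrictVars_restrictVars, Set.singleton_inter_eq_empty.mpr hk, restrictVars_empty,
      ← constantCoeff_algEquiv hz hΦ, AlgEquiv.apply_symm_apply]
  have h2 : restrictVars K {k} (Φ.symm (Polynomial.aeval (z k) p)) =
      Polynomial.aeval (X k : MvPowerSeries (Fin n) K) (p.map ε) := by
    change χ (Polynomial.aeval (z k) p) = _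
    rw [Polynomial.aeval_def, Polynomial.hom_eval₂, Polynomial.aeval_def, Polynomial.eval₂_map]
    have h3 : χ (z k) = X k := by
      change restrictVars K {k} (Φ.symm (z k)) = X k
      rw [← algEquiv_X hz hΦ, AlgEquiv.symm_apply_apply,
        restrictVars_X_of_mem (Set.mem_singleton k)]
    rw [h3]
    congr 1
    ext1 a
    exact hχ a
  rw [h2]
  exact aeval_X_ne_zero_of_monic (hp.map ε) k

theorem mem_span_of_mul_mem_of_mem_seriesIn (hΦ : ∀ a, Φ a = subst z a) {k : Fin n}
    {f : MvPowerSeries (Fin n) K} (hfk : restrictVars K {k} (Φ.symm f) ≠ 0) {ι : Type*} [Finite ι]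
    {g : ι → MvPowerSeries (Fin n) K} (hg : ∀ i, g i ∈ seriesIn z hz {k}ᶜ)
    {a : MvPowerSeries (Fin n) K} (ha : a * f ∈ Ideal.span (Set.range g)) :
    a ∈ Ideal.span (Set.range g) := by
  obtain ⟨e, he⟩ := exists_isRegularInVar hfk
  have h1 : Ideal.map Φ.symm (Ideal.span (Set.range g)) =
      Ideal.span (Set.range fun i => Φ.symm (g i)) := by
    rw [Ideal.map_span, ← Set.range_comp]; rfl
  have h2 : Φ.symm a * Φ.symm f ∈ Ideal.span (Set.range fun i => Φ.symm (g i)) := by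
    rw [← map_mul, ← h1]; exact Ideal.mem_map_of_mem _ ha
  have h3 := he.mem_span_of_mul_mem (fun i => (mem_seriesIn_iff hΦ).mp (hg i)) h2
  have h4 := Ideal.mem_map_of_mem Φ h3
  rw [Ideal.map_span, ← Set.range_comp, AlgEquiv.apply_symm_apply] at h4
  simpa [Function.comp_def] using h4

/-- Iterated Weierstrass division by monic polynomials in one variable each. -/
theorem exists_sub_mem_of_forall_aeval_mem (hΦ : ∀ a, Φ a = subst z a) {d : ℕ} (hdn : d ≤ n)
    (p : Fin n → Polynomial (seriesIn z hz {i | i.val < d})) (hp : ∀ k, (p k).Monic)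
    {J : Ideal (MvPowerSeries (Fin n) K)}
    (hJ : ∀ k : Fin n, d ≤ k.val → Polynomial.aeval (z k) (p k) ∈ J)
    (a : MvPowerSeries (Fin n) K) :
    ∃ b ∈ polyIn z hz {i | i.val < d} {i | d ≤ i.val}, a - b ∈ J := by
  -- Eliminate power series variables from the top: dividing by the equation of `z m` leaves a
  -- polynomial in `z m` with coefficients in one variable fewer, to which induction applies.
  have key : ∀ m, d ≤ m → m ≤ n → ∀ a ∈ seriesIn z hz {i | i.val < m},
      ∃ b ∈ polyIn z hz {i | i.val < d} {i | d ≤ i.val}, a - b ∈ J := by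
    intro m hdm
    induction m, hdm using Nat.le_induction with
    | base =>
      intro _ a ha
      exact ⟨a, seriesIn_le_polyIn z hz _ _ ha, by rw [sub_self]; exact zero_mem J⟩
    | succ m hdm ih =>
      intro hmn a ha
      let k : Fin n := ⟨m, hmn⟩
      have hks : k ∉ {i : Fin n | i.val < d} := not_lt.mpr hdm
      have hsub : insert k {i : Fin n | i.val < d} ⊆ {i | i.val < m + 1} := by
        refine Set.insert_subset (Nat.lt_succ_self m) fun i hi => ?_
        have : i.val < d := hi
        exact show i.val < m + 1 by omega
      obtain ⟨e, he⟩ := exists_eq_sum_add_mul_of_mem_seriesIn hΦ (Nat.lt_succ_self m : k.val < m + 1)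
        (seriesIn_mono hΦ hsub (aeval_coord_mem_seriesIn hΦ k (p k)))
        (restrictVars_aeval_coord_ne_zero hΦ hks (hp k))
      obtain ⟨b, hb, c, -, hab⟩ := he a ha
      have hst : {i : Fin n | i.val < m + 1} \ {k} = {i | i.val < m} := by
        ext i
        simp only [Set.mem_sdiff, Set.mem_ofPred_eq, Set.mem_singleton_iff, k, Fin.ext_iff]
        omega
      rw [hst] at hb
      choose b' hb' hbb' using fun j => ih (by omega) (b j) (hb j)
      have hzk : z k ∈ polyIn z hz {i | i.val < d} {i | d ≤ i.val} :=
        Subring.subset_closure (Or.inr ⟨k, hdm, rfl⟩)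
      refine ⟨∑ j ∈ Finset.range e, b' j * z k ^ j,
        sum_mem fun j _ => mul_mem (hb' j) (pow_mem hzk j), ?_⟩
      have h1 : a - ∑ j ∈ Finset.range e, b' j * z k ^ j =
          ∑ j ∈ Finset.range e, (b j - b' j) * z k ^ j + c * Polynomial.aeval (z k) (p k) := by
        simp only [sub_mul, Finset.sum_sub_distrib]
        rw [hab]; ring
      rw [h1]
      exact add_mem (sum_mem fun j _ => Ideal.mul_mem_right _ _ (hbb' j))
        (Ideal.mul_mem_left _ _ (hJ k hdm))
  refine key n hdn le_rfl a ?_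
  have : {i : Fin n | i.val < n} = Set.univ := by ext i; simp
  rw [this, seriesIn_univ hΦ]
  trivial

/-- A prime ideal over which the coefficient ring injects is minimal over the ideal generated by
integral equations of the remaining coordinates. -/
theorem mem_minimalPrimes_of_forall_aeval_mem (hΦ : ∀ a, Φ a = subst z a) {d : ℕ} (hdn : d ≤ n)
    (p : Fin n → Polynomial (seriesIn z hz {i | i.val < d})) (hp : ∀ k, (p k).Monic)
    {P J : Ideal (MvPowerSeries (Fin n) K)} [P.IsPrime] (hJP : J ≤ P)
    (hJ : ∀ k : Fin n, d ≤ k.val → Polynomial.aeval (z k) (p k) ∈ J)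
    (hinj : ∀ f ∈ seriesIn z hz {i | i.val < d}, f ∈ P → f = 0) :
    P ∈ J.minimalPrimes := by
  refine ⟨⟨‹_›, hJP⟩, fun Q ⟨hQ, hJQ⟩ hQP x hxP => ?_⟩
  by_contra hxQ
  let ι := (seriesIn z hz {i : Fin n | i.val < d}).subtype
  let φ : seriesIn z hz {i : Fin n | i.val < d} →+* MvPowerSeries (Fin n) K ⧸ Q :=
    (Ideal.Quotient.mk Q).comp ι
  -- Incomparability for `Q ≤ P`: modulo `Q` everything is congruent to a polynomial, hence integral
  -- over the coefficient ring. An integral equation of `x ∈ P \ Q` would have a coefficient in `P`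
  -- but not in `Q`, while `P` meets that ring only in zero.
  have hint : ∀ b ∈ polyIn z hz {i : Fin n | i.val < d} {i | d ≤ i.val},
      IsIntegral (seriesIn z hz {i : Fin n | i.val < d}) (Ideal.Quotient.mk Q b) := by
    intro b hb
    suffices h : polyIn z hz {i : Fin n | i.val < d} {i | d ≤ i.val} ≤
        (integralClosure (seriesIn z hz {i : Fin n | i.val < d})
          (MvPowerSeries (Fin n) K ⧸ Q)).toSubring.comap (Ideal.Quotient.mk Q) from h hb
    refine Subring.closure_le.mpr ?_
    rintro b (hb | ⟨k, hk, rfl⟩)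
    · exact isIntegral_algebraMap (R := seriesIn z hz {i : Fin n | i.val < d}) (x := ⟨b, hb⟩)
    · refine ⟨p k, hp k, ?_⟩
      have h1 := Polynomial.hom_eval₂ (p k) ι (Ideal.Quotient.mk Q) (z k)
      change Polynomial.eval₂ φ (Ideal.Quotient.mk Q (z k)) (p k) = 0
      rw [← h1]
      exact Ideal.Quotient.eq_zero_iff_mem.mpr (hJQ (hJ k hk))
  obtain ⟨b, hb, hab⟩ := exists_sub_mem_of_forall_aeval_mem hΦ hdn p hp hJ x
  obtain ⟨q, hq, hqx⟩ := hint b hb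
  have hxb : Ideal.Quotient.mk Q b = Ideal.Quotient.mk Q x :=
    (Ideal.Quotient.eq.mpr (hJQ hab)).symm
  have hqQ : Polynomial.eval₂ ι x q ∈ Q := by
    rw [← Ideal.Quotient.eq_zero_iff_mem, Polynomial.hom_eval₂, ← hxb]
    exact hqx
  have : Nontrivial (seriesIn z hz {i : Fin n | i.val < d} ⧸ Q.comap ι) :=
    Ideal.Quotient.nontrivial_iff.mpr (hQ.comap ι).ne_top
  obtain ⟨i, hi1, hi2⟩ := Ideal.exists_coeff_mem_comap_sdiff_comap_of_root_mem_sdiff (f := ι) hQP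
    ⟨hxP, hxQ⟩ (hq.map _).ne_zero hqQ
  refine hi2 ?_
  have h0 := hinj _ (q.coeff i).2 hi1
  change (q.coeff i : MvPowerSeries (Fin n) K) ∈ Q
  rw [h0]
  exact zero_mem Q

end Equations

/-! ### A criterion for being an adic completion. -/

section Completion

variable {D A : Type*} [CommRing D] [CommRing A] [Algebra D A]

/-- `I ^ k A` is spanned by images of elements of `D`, so approximating only the coefficients to
first order improves the precision from `k` to `k + 1`. -/
theorem exists_sub_algebraMap_mem_map_pow {I : Ideal D}
    (h : ∀ a : A, ∃ d : D, a - algebraMap D A d ∈ I.map (algebraMap D A)) (k : ℕ) (a : A) :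
    ∃ d : D, a - algebraMap D A d ∈ I.map (algebraMap D A) ^ k := by
  have key : ∀ k, ∀ a ∈ I.map (algebraMap D A) ^ k, ∃ d : D,
      a - algebraMap D A d ∈ I.map (algebraMap D A) ^ (k + 1) := by
    intro k a ha
    rw [← Ideal.map_pow, Ideal.map] at ha
    induction ha using Submodule.span_induction with
    | mem x hx =>
      obtain ⟨d, -, rfl⟩ := hx
      exact ⟨d, by rw [sub_self]; exact zero_mem _⟩
    | zero => exact ⟨0, by simp⟩
    | add x y _ _ hx hy =>
      obtain ⟨d, hd⟩ := hx
      obtain ⟨d', hd'⟩ := hy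
      exact ⟨d + d', by simpa [add_sub_add_comm] using add_mem hd hd'⟩
    | smul c x hx' hx =>
      obtain ⟨d, hd⟩ := hx
      obtain ⟨c', hc'⟩ := h c
      have hx'' : x ∈ I.map (algebraMap D A) ^ k := by rw [← Ideal.map_pow]; exact hx'
      refine ⟨c' * d, ?_⟩
      have : c • x - algebraMap D A (c' * d) =
          (c - algebraMap D A c') * x + algebraMap D A c' * (x - algebraMap D A d) := by
        rw [smul_eq_mul, map_mul]; ring
      rw [this]
      refine add_mem ?_ (Ideal.mul_mem_left _ _ hd)
      rw [pow_succ']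
      exact Ideal.mul_mem_mul hc' hx''
  induction k with
  | zero => exact ⟨0, by simp⟩
  | succ k ih =>
    obtain ⟨d, hd⟩ := ih
    obtain ⟨d', hd'⟩ := key k _ hd
    exact ⟨d + d', by simpa [sub_sub] using hd'⟩

/-- A complete algebra `A` over `D` such that all maps `D ⧸ I ^ k → A ⧸ I ^ k A` are bijective is
the completion of `D`. -/
theorem nonempty_adicCompletion_algEquiv (I : Ideal D)
    (hcomp : IsAdicComplete (I.map (algebraMap D A)) A)
    (hsurj : ∀ a : A, ∃ d : D, a - algebraMap D A d ∈ I.map (algebraMap D A))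
    (hinj : ∀ k, ∀ d : D, algebraMap D A d ∈ I.map (algebraMap D A) ^ k → d ∈ I ^ k) :
    Nonempty (AdicCompletion I D ≃ₐ[D] A) := by
  let J := I.map (algebraMap D A)
  have hle : ∀ k, I ^ k ≤ (J ^ k).comap (algebraMap D A) := fun k => by
    rw [← Ideal.map_le_iff_le_comap, Ideal.map_pow]
  let q : ∀ k, D ⧸ I ^ k →ₐ[D] A ⧸ J ^ k := fun k =>
    Ideal.quotientMapₐ (J ^ k) (Algebra.ofId D A) (hle k)
  have hq : ∀ k d, q k (Ideal.Quotient.mk _ d) = Ideal.Quotient.mk _ (algebraMap D A d) :=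
    fun k d => rfl
  have hqinj : ∀ k, Function.Injective (q k) := by
    intro k
    rw [injective_iff_map_eq_zero]
    intro x hx
    obtain ⟨d, rfl⟩ := Ideal.Quotient.mk_surjective x
    rw [hq, Ideal.Quotient.eq_zero_iff_mem] at hx
    exact Ideal.Quotient.eq_zero_iff_mem.mpr (hinj k d hx)
  let F : ∀ k, AdicCompletion I D →ₐ[D] A ⧸ J ^ k := fun k => (q k).comp (AdicCompletion.evalₐ I k)
  have hF : ∀ k (s : AdicCompletion.AdicCauchySequence I D),
      F k (AdicCompletion.mk I D s) = Ideal.Quotient.mk _ (algebraMap D A (s k)) := by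
    intro k s
    change q k (AdicCompletion.evalₐ I k (AdicCompletion.mk I D s)) = _
    rw [AdicCompletion.evalₐ_mk, hq]
  have hFc : ∀ {m n : ℕ} (hle : m ≤ n),
      (Ideal.Quotient.factorₐ D (Ideal.pow_le_pow_right hle)).comp (F n) = F m := by
    intro m n hmn
    ext x
    induction x using AdicCompletion.induction_on with
    | _ s =>
      rw [AlgHom.comp_apply, hF, hF]
      change Ideal.Quotient.mk (J ^ m) (algebraMap D A (s n)) = _
      rw [Ideal.Quotient.eq, ← map_sub]
      have h1 := (s.2 hmn).symm
      rw [SModEq.sub_mem] at h1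
      exact hle m (by simpa using h1)
  let G : AdicCompletion I D →ₐ[D] A := IsAdicComplete.liftAlgHom J F hFc
  have hG : ∀ k x, Ideal.Quotient.mk (J ^ k) (G x) = F k x := fun k x =>
    IsAdicComplete.mk_liftAlgHom J F hFc k x
  refine ⟨AlgEquiv.ofBijective G ⟨?_, fun a => ?_⟩⟩
  · rw [injective_iff_map_eq_zero]
    intro x hx
    refine AdicCompletion.ext_evalₐ fun k => hqinj k ?_
    have h1 := hG k x
    rw [hx, map_zero] at h1
    rw [map_zero, map_zero]
    exact h1.symm
  · choose d hd using fun k => exists_sub_algebraMap_mem_map_pow hsurj k a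
    -- The approximations agree modulo `J ^ k` in `A`; contractedness of the powers of `I` makes
    -- them Cauchy in `D` itself.
    have hcau : ∀ k, d k ≡ d (k + 1) [SMOD (I ^ k • ⊤ : Submodule D D)] := by
      intro k
      rw [SModEq.sub_mem]
      have h1 : d k - d (k + 1) ∈ I ^ k := by
        refine hinj k _ ?_
        have h2 := sub_mem (Ideal.pow_le_pow_right (Nat.le_succ k) (hd (k + 1))) (hd k)
        rw [map_sub]
        convert h2 using 1
        ring
      simpa using h1
    refine ⟨AdicCompletion.mk I D (AdicCompletion.AdicCauchySequence.mk I D d hcau), ?_⟩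
    rw [← sub_eq_zero]
    refine hcomp.toIsHausdorff.haus _ fun k => ?_
    rw [SModEq.zero]
    have h1 := hG k (AdicCompletion.mk I D (AdicCompletion.AdicCauchySequence.mk I D d hcau))
    rw [hF] at h1
    have h2 : Ideal.Quotient.mk (J ^ k) (algebraMap D A (d k)) = Ideal.Quotient.mk (J ^ k) a :=
      (Ideal.Quotient.eq.mpr (hd k)).symm
    have h3 := Ideal.Quotient.eq.mp (h1.trans h2)
    simpa [J] using h3

end Completion

/-! ### The ring `D`: local, Noetherian, with contracted powers of `(Z₂)`. -/

section LocalRing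

variable {K : Type*} [Field K] {n : ℕ} {z : Fin n → MvPowerSeries (Fin n) K}
  {hz : ∀ i, constantCoeff (z i) = 0}

theorem polyIn_le_localPolyIn (z : Fin n → MvPowerSeries (Fin n) K)
    (hz : ∀ i, constantCoeff (z i) = 0) (s t : Set (Fin n)) :
    polyIn z hz s t ≤ localPolyIn z hz s t :=
  fun a ha => ⟨⟨a, ha⟩, 1, (Ideal.ne_top_iff_one _).mp (varIdeal_isPrime z hz s t).ne_top, by simp⟩

/-- For `a = b / c` a unit among power series, `b` also has nonzero constant term, so `c / b` is an
admissible fraction. -/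
theorem isUnit_of_isUnit_coe_localPolyIn {s t : Set (Fin n)} (a : localPolyIn z hz s t)
    (ha : IsUnit (a : MvPowerSeries (Fin n) K)) : IsUnit a := by
  obtain ⟨b, c, hc, hcb⟩ := a.2
  obtain ⟨u, hu⟩ := ha.exists_right_inv
  have hb : b ∉ varIdeal z hz s t := by
    rw [mem_varIdeal_iff] at hc ⊢
    rw [← hcb, map_mul]
    refine mul_ne_zero hc ?_
    exact (isUnit_iff_constantCoeff.mp ha).ne_zero
  refine IsUnit.of_mul_eq_one ⟨u, c, b, hb, ?_⟩ (Subtype.ext hu)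
  rw [← hcb]
  linear_combination (c : MvPowerSeries (Fin n) K) * hu

instance {s t : Set (Fin n)} :
    IsLocalHom (algebraMap (localPolyIn z hz s t) (MvPowerSeries (Fin n) K)) :=
  ⟨fun a ha => isUnit_of_isUnit_coe_localPolyIn a ha⟩

instance {s t : Set (Fin n)} : IsLocalRing (localPolyIn z hz s t) :=
  (algebraMap (localPolyIn z hz s t) (MvPowerSeries (Fin n) K)).domain_isLocalRing

/-- Every element of the local ring is a unit multiple of a polynomial. -/
theorem exists_mul_eq_inclusion {s t : Set (Fin n)} (a : localPolyIn z hz s t) :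
    ∃ (b : polyIn z hz s t) (u : localPolyIn z hz s t), IsUnit u ∧
      u * a = Subring.inclusion (polyIn_le_localPolyIn z hz s t) b := by
  obtain ⟨b, c, hc, hcb⟩ := a.2
  refine ⟨b, Subring.inclusion (polyIn_le_localPolyIn z hz s t) c, ?_, Subtype.ext hcb⟩
  refine isUnit_of_isUnit_coe_localPolyIn _ (isUnit_iff_constantCoeff.mpr ?_)
  rw [mem_varIdeal_iff] at hc
  exact (Ne.isUnit hc)

theorem polyIn_eq_range (s t : Set (Fin n)) :
    polyIn z hz s t =
      (MvPolynomial.eval₂Hom (seriesIn z hz s).subtype fun j : t => z j).range := by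
  refine le_antisymm (Subring.closure_le.mpr ?_) ?_
  · rintro a (ha | ⟨j, hj, rfl⟩)
    · exact ⟨MvPolynomial.C ⟨a, ha⟩, by simp⟩
    · exact ⟨MvPolynomial.X ⟨j, hj⟩, by simp⟩
  · rintro _ ⟨p, rfl⟩
    induction p using MvPolynomial.induction_on with
    | C a => simpa using seriesIn_le_polyIn z hz s t a.2
    | add p q hp hq => rw [map_add]; exact add_mem hp hq
    | mul_X p j hp =>
      rw [map_mul]
      refine mul_mem hp ?_
      rw [MvPolynomial.coe_eval₂Hom, MvPolynomial.eval₂_X]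
      exact Subring.subset_closure (Or.inr ⟨j, j.2, rfl⟩)

instance {s : Set (Fin n)} : IsNoetherianRing (seriesIn z hz s) :=
  inferInstanceAs (IsNoetherianRing (substHom z hz s).toRingHom.range)

instance {s t : Set (Fin n)} : IsNoetherianRing (polyIn z hz s t) := by
  rw [polyIn_eq_range]
  infer_instance

instance {s t : Set (Fin n)} : IsNoetherianRing (localPolyIn z hz s t) := by
  rw [isNoetherianRing_iff_ideal_fg]
  intro I
  let i := Subring.inclusion (polyIn_le_localPolyIn z hz s t)
  -- Every ideal is extended from the polynomial ring, because each element is a polynomial up to a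
  -- unit; finite generation is inherited.
  have h : (I.comap i).map i = I := by
    refine le_antisymm Ideal.map_comap_le fun a ha => ?_
    obtain ⟨b, u, hu, hub⟩ := exists_mul_eq_inclusion a
    have hb : i b ∈ (I.comap i).map i := by
      refine Ideal.mem_map_of_mem _ ?_
      rw [Ideal.mem_comap, ← hub]
      exact Ideal.mul_mem_left _ _ ha
    rw [← hub] at hb
    exact (Ideal.unit_mul_mem_iff_mem _ hu).mp hb
  rw [← h]
  exact (Ideal.fg_of_isNoetherianRing _).map i

variable {Φ : MvPowerSeries (Fin n) K ≃ₐ[K] MvPowerSeries (Fin n) K}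

theorem mem_span_coord_pow_iff (hz : ∀ i, constantCoeff (z i) = 0)
    (hΦ : ∀ a, Φ a = subst z a) (t : Finset (Fin n)) (k : ℕ) (a : MvPowerSeries (Fin n) K) :
    a ∈ Ideal.span (z '' t) ^ k ↔ Φ.symm a ∈ partialDegIdeal K t k := by
  have h : Ideal.map Φ (partialDegIdeal K t k) = Ideal.span (z '' t) ^ k := by
    rw [← span_X_pow_eq_partialDegIdeal, Ideal.map_pow, Ideal.map_span, ← Set.image_comp]
    congr 3
    ext1 i
    exact algEquiv_X hz hΦ i
  rw [← h]
  constructor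
  · intro ha
    obtain ⟨b, hb, rfl⟩ := (Ideal.mem_map_iff_of_surjective Φ Φ.surjective).mp ha
    rwa [AlgEquiv.symm_apply_apply]
  · intro ha
    have := Ideal.mem_map_of_mem Φ ha
    rwa [AlgEquiv.apply_symm_apply] at this

theorem exists_sub_mem_span_coord (hΦ : ∀ a, Φ a = subst z a) (t : Finset (Fin n))
    (a : MvPowerSeries (Fin n) K) :
    ∃ b ∈ seriesIn z hz (t : Set (Fin n))ᶜ, a - b ∈ Ideal.span (z '' t) := by
  refine ⟨Φ (restrictVars K (t : Set (Fin n))ᶜ (Φ.symm a)), map_restrictVars_mem_seriesIn hΦ _ _,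
    ?_⟩
  rw [← pow_one (Ideal.span (z '' t)), mem_span_coord_pow_iff hz hΦ, map_sub,
    AlgEquiv.symm_apply_apply]
  intro m hm
  rw [map_sub, coeff_restrictVars_of_subset, sub_self]
  intro i hi hit
  have := Finset.sum_eq_zero_iff.mp (Nat.lt_one_iff.mp hm) i hit
  simp [this] at hi

/-- As `c` is free of the variables in `t`, every monomial of the product has exactly the `t`-degree
of `μ`. -/
theorem coeff_mul_monomial_eq_zero_of_lt {t : Finset (Fin n)} {c : MvPowerSeries (Fin n) K}
    (hc : restrictVars K (t : Set (Fin n))ᶜ c = c) {μ m : Fin n →₀ ℕ}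
    (hlt : ∑ i ∈ t, μ i < ∑ i ∈ t, m i) : coeff m (c * monomial μ 1) = 0 := by
  classical
  rw [coeff_mul_monomial, mul_one]
  split_ifs with hle
  · rw [← hc]
    refine coeff_restrictVars_of_not_subset _ fun hsub => ?_
    refine absurd hlt (not_lt.mpr (Finset.sum_le_sum fun i hi => ?_))
    by_contra hcon
    have : i ∈ ((m - μ).support : Set (Fin n)) := by simp; omega
    exact hsub this hi
  · rfl

/-- The powers of the ideal generated by the polynomial variables are contracted from the power
series ring. -/
theorem mem_span_pow_of_coe_mem (hΦ : ∀ a, Φ a = subst z a) (t : Finset (Fin n)) (k : ℕ)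
    (a : localPolyIn z hz (t : Set (Fin n))ᶜ t)
    (ha : (a : MvPowerSeries (Fin n) K) ∈ Ideal.span (z '' t) ^ k) :
    a ∈ Ideal.span {d : localPolyIn z hz (t : Set (Fin n))ᶜ t |
      ∃ j ∈ (t : Set (Fin n)), (d : MvPowerSeries (Fin n) K) = z j} ^ k := by
  classical
  let D := localPolyIn z hz (t : Set (Fin n))ᶜ t
  let I := Ideal.span {d : D | ∃ j ∈ (t : Set (Fin n)), (d : MvPowerSeries (Fin n) K) = z j}
  change a ∈ I ^ k
  obtain ⟨b, u, hu, hub⟩ := exists_mul_eq_inclusion a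
  have hbA : (b : MvPowerSeries (Fin n) K) ∈ Ideal.span (z '' t) ^ k := by
    have : (b : MvPowerSeries (Fin n) K) = u * a := congrArg Subtype.val hub.symm
    rw [this]
    exact Ideal.mul_mem_left _ _ ha
  rw [← Ideal.unit_mul_mem_iff_mem _ hu, hub]
  obtain ⟨p, hp⟩ := (polyIn_eq_range (z := z) (hz := hz) (t : Set (Fin n))ᶜ t).le b.2
  rw [MvPolynomial.coe_eval₂Hom, MvPolynomial.eval₂_eq'] at hp
  let zD : t → D := fun j => ⟨z j, polyIn_le_localPolyIn z hz _ _
    (Subring.subset_closure (Or.inr ⟨j, j.2, rfl⟩))⟩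
  let cD : seriesIn z hz (t : Set (Fin n))ᶜ → D :=
    Subring.inclusion (seriesIn_le_localPolyIn z hz _ _)
  let T : ((t : Set (Fin n)) →₀ ℕ) → D := fun ν => cD (p.coeff ν) * ∏ i, zD i ^ ν i
  have hTb : Subring.inclusion (polyIn_le_localPolyIn z hz _ _) b = ∑ ν ∈ p.support, T ν := by
    refine Subtype.ext ?_
    rw [AddSubmonoidClass.coe_finsetSum]
    refine hp.symm.trans (Finset.sum_congr rfl fun ν _ => ?_)
    simp only [T, Subring.coe_mul, SubmonoidClass.coe_finsetProd, SubmonoidClass.coe_pow]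
    rfl
  have hhigh : ∀ ν, k ≤ ∑ i, ν i → T ν ∈ I ^ k := by
    intro ν hν
    refine Ideal.mul_mem_left _ _ (Ideal.pow_le_pow_right hν ?_)
    rw [← Finset.prod_pow_eq_pow_sum]
    have hzD : ∀ i, zD i ∈ I := fun i => Ideal.subset_span ⟨i, i.2, rfl⟩
    exact Ideal.prod_mem_prod fun i _ => Ideal.pow_mem_pow (hzD i) _
  have hIA : ∀ d ∈ I ^ k, (d : MvPowerSeries (Fin n) K) ∈ Ideal.span (z '' t) ^ k := by
    intro d hd
    have h1 := Ideal.mem_map_of_mem D.subtype hd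
    rw [Ideal.map_pow, Ideal.map_span] at h1
    refine Ideal.pow_right_mono (Ideal.span_mono ?_) k h1
    rintro _ ⟨d, ⟨j, hj, hd⟩, rfl⟩
    exact ⟨j, hj, hd.symm⟩
  -- Split the polynomial at degree `k`. The high terms visibly lie in `I ^ k`. The low part has no
  -- coefficients of `t`-degree below `k` by hypothesis and none from `k` on by its shape, so it
  -- vanishes.
  rw [hTb, ← Finset.sum_filter_add_sum_filter_not _ fun ν : ((t : Set (Fin n)) →₀ ℕ) => k ≤ ∑ i, ν i]
  have hhs : ∑ ν ∈ p.support with k ≤ ∑ i, ν i, T ν ∈ I ^ k :=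
    Ideal.sum_mem _ fun ν hν => hhigh ν (Finset.mem_filter.mp hν).2
  refine add_mem hhs ?_
  have hlow : ((∑ ν ∈ p.support with ¬ k ≤ ∑ i, ν i, T ν : D) : MvPowerSeries (Fin n) K) ∈
      Ideal.span (z '' t) ^ k := by
    have h1 := congrArg (Subtype.val : D → MvPowerSeries (Fin n) K) hTb
    rw [← Finset.sum_filter_add_sum_filter_not _
      fun ν : ((t : Set (Fin n)) →₀ ℕ) => k ≤ ∑ i, ν i, Subring.coe_add] at h1
    change (b : MvPowerSeries (Fin n) K) = _ at h1
    have h2 := sub_mem hbA (hIA _ hhs)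
    rwa [h1, add_sub_cancel_left] at h2
  suffices h0 : (∑ ν ∈ p.support with ¬ k ≤ ∑ i, ν i, T ν : D) = 0 by
    rw [h0]; exact zero_mem _
  refine Subtype.ext (Φ.symm.injective ?_)
  rw [mem_span_coord_pow_iff hz hΦ] at hlow
  change _ = Φ.symm 0
  rw [map_zero]
  ext m
  rw [map_zero]
  rcases lt_or_ge (∑ i ∈ t, m i) k with hm | hm
  · exact hlow m hm
  · rw [AddSubmonoidClass.coe_finsetSum, map_sum, map_sum]
    refine Finset.sum_eq_zero fun ν hν => ?_
    have hν' : ∑ i, ν i < k := not_le.mp (Finset.mem_filter.mp hν).2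
    let μ : Fin n →₀ ℕ := ν.embDomain (Function.Embedding.subtype (· ∈ (t : Set (Fin n))))
    have hμ : ∑ i ∈ t, μ i = ∑ i, ν i := by
      rw [← Finset.sum_coe_sort]
      exact Finset.sum_congr rfl fun i _ => Finsupp.embDomain_apply_self
        (Function.Embedding.subtype (· ∈ (t : Set (Fin n)))) ν i
    have hT : Φ.symm (T ν) =
        Φ.symm (p.coeff ν : seriesIn z hz (t : Set (Fin n))ᶜ) * monomial μ 1 := by
      have h1 : (T ν : MvPowerSeries (Fin n) K) =
          (p.coeff ν : seriesIn z hz (t : Set (Fin n))ᶜ) * ∏ i : t, z i ^ ν i := by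
        simp only [T, Subring.coe_mul, SubmonoidClass.coe_finsetProd, SubmonoidClass.coe_pow]
        rfl
      have hzi : ∀ i, Φ.symm (z i) = X i := fun i => by
        rw [← algEquiv_X hz hΦ, AlgEquiv.symm_apply_apply]
      rw [h1, map_mul, map_prod]
      simp only [map_pow, hzi]
      congr 1
      rw [monomial_one_eq, Finsupp.prod_embDomain, Finsupp.prod_fintype _ _ (by simp)]
      rfl
    rw [hT]
    exact coeff_mul_monomial_eq_zero_of_lt ((mem_seriesIn_iff hΦ).mp (p.coeff ν).2)
      (lt_of_eq_of_lt hμ (hν'.trans_le hm))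

end LocalRing

/-! ### Both completions of `D`, and the sequence of equations. -/

section Coordinates

variable {K : Type*} [Field K] {n : ℕ} {z : Fin n → MvPowerSeries (Fin n) K}
  {hz : ∀ i, constantCoeff (z i) = 0}
  {Φ : MvPowerSeries (Fin n) K ≃ₐ[K] MvPowerSeries (Fin n) K}

theorem nonempty_adicCompletion_coord_algEquiv (hΦ : ∀ a, Φ a = subst z a) {s t : Set (Fin n)}
    (hst : s = tᶜ) :
    Nonempty (AdicCompletion (Ideal.span {d : localPolyIn z hz s t |
      ∃ j ∈ t, (d : MvPowerSeries (Fin n) K) = z j}) (localPolyIn z hz s t)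
        ≃ₐ[localPolyIn z hz s t] MvPowerSeries (Fin n) K) := by
  subst hst
  lift t to Finset (Fin n) using t.toFinite
  let I := Ideal.span {d : localPolyIn z hz (t : Set (Fin n))ᶜ t |
      ∃ j ∈ (t : Set (Fin n)), (d : MvPowerSeries (Fin n) K) = z j}
  have hmap : I.map (algebraMap _ (MvPowerSeries (Fin n) K)) = Ideal.span (z '' t) := by
    rw [Ideal.map_span]
    congr 1
    ext a
    constructor
    · rintro ⟨d, ⟨j, hj, hd⟩, rfl⟩
      exact ⟨j, hj, hd.symm⟩
    · rintro ⟨j, hj, rfl⟩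
      exact ⟨⟨z j, polyIn_le_localPolyIn z hz _ _ (Subring.subset_closure (Or.inr ⟨j, hj, rfl⟩))⟩,
        ⟨j, hj, rfl⟩, rfl⟩
  refine nonempty_adicCompletion_algEquiv I ?_ (fun a => ?_) fun k d hd => ?_
  · rw [hmap, Set.image_eq_range]
    exact isAdicComplete_span_range _ fun j => hz j
  · rw [hmap]
    obtain ⟨b, hb, hab⟩ := exists_sub_mem_span_coord (hz := hz) hΦ t a
    exact ⟨⟨b, seriesIn_le_localPolyIn z hz _ _ hb⟩, hab⟩
  · rw [hmap] at hd
    exact mem_span_pow_of_coe_mem hΦ t k d hd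

/-- The completion of a Noetherian ring is flat, and a flat local homomorphism is faithfully flat.
-/
theorem faithfullyFlat_localPolyIn (hΦ : ∀ a, Φ a = subst z a) {s t : Set (Fin n)}
    (hst : s = tᶜ) : Module.FaithfullyFlat (localPolyIn z hz s t) (MvPowerSeries (Fin n) K) := by
  obtain ⟨e⟩ := nonempty_adicCompletion_coord_algEquiv (hz := hz) hΦ hst
  have : Module.Flat (localPolyIn z hz s t) (MvPowerSeries (Fin n) K) :=
    Module.Flat.of_linearEquiv e.symm.toLinearEquiv
  exact Module.FaithfullyFlat.of_flat_of_isLocalHom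

/-- Faithful flatness gives `I ^ k A ∩ D = I ^ k` for any ideal, which replaces the degree argument
used for `(Z₂)`. -/
theorem nonempty_adicCompletion_span_algEquiv (hΦ : ∀ a, Φ a = subst z a) {s t : Set (Fin n)}
    (hst : s = tᶜ) {ι : Type*} [Finite ι] {f : ι → MvPowerSeries (Fin n) K}
    (hf0 : ∀ i, constantCoeff (f i) = 0) (hfD : ∀ i, f i ∈ localPolyIn z hz s t)
    (hsurj : ∀ a, ∃ b ∈ localPolyIn z hz s t, a - b ∈ Ideal.span (Set.range f)) :
    Nonempty (AdicCompletion (Ideal.span {d : localPolyIn z hz s t |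
      ∃ i, (d : MvPowerSeries (Fin n) K) = f i}) (localPolyIn z hz s t)
        ≃ₐ[localPolyIn z hz s t] MvPowerSeries (Fin n) K) := by
  let I := Ideal.span {d : localPolyIn z hz s t | ∃ i, (d : MvPowerSeries (Fin n) K) = f i}
  have hmap : I.map (algebraMap _ (MvPowerSeries (Fin n) K)) = Ideal.span (Set.range f) := by
    rw [Ideal.map_span]
    congr 1
    ext a
    constructor
    · rintro ⟨d, ⟨i, hd⟩, rfl⟩
      exact ⟨i, hd.symm⟩
    · rintro ⟨i, rfl⟩
      exact ⟨⟨f i, hfD i⟩, ⟨i, rfl⟩, rfl⟩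
  have := faithfullyFlat_localPolyIn (hz := hz) hΦ hst
  refine nonempty_adicCompletion_algEquiv I ?_ (fun a => ?_) fun k d hd => ?_
  · rw [hmap]
    exact isAdicComplete_span_range _ hf0
  · rw [hmap]
    obtain ⟨b, hb, hab⟩ := hsurj a
    exact ⟨⟨b, hb⟩, hab⟩
  · rw [← Ideal.map_pow] at hd
    rwa [← Ideal.comap_map_eq_self_of_faithfullyFlat (B := MvPowerSeries (Fin n) K) (I ^ k)]

/-- The equations preceding the `i`-th do not involve `z (k i)`, while the `i`-th is regular in it
and hence a nonzerodivisor modulo them. -/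
theorem isRegular_ofFn_aeval_coord (hΦ : ∀ a, Φ a = subst z a) {d r : ℕ} (hdr : d + r = n)
    (p : Fin n → Polynomial (seriesIn z hz {i | i.val < d})) (hp : ∀ k, (p k).Monic)
    {P : Ideal (MvPowerSeries (Fin n) K)} (hP : P ≠ ⊤)
    (hpP : ∀ k, Polynomial.aeval (z k) (p k) ∈ P) (k : Fin r → Fin n)
    (hk : ∀ i, (k i).val = n - 1 - i.val) :
    RingTheory.Sequence.IsRegular (MvPowerSeries (Fin n) K)
      (List.ofFn fun i => Polynomial.aeval (z (k i)) (p (k i))) := by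
  refine isRegular_ofFn_of_forall_mem _ (fun h => hP ?_) fun i a ha => ?_
  · refine top_le_iff.mp (h.ge.trans (Ideal.span_le.mpr ?_))
    rintro _ ⟨i, rfl⟩
    exact hpP (k i)
  · have hks : k i ∉ {j : Fin n | j.val < d} := fun h => by
      have h1 : (k i).val < d := h
      have := hk i
      omega
    refine mem_span_of_mul_mem_of_mem_seriesIn (hz := hz) hΦ
      (restrictVars_aeval_coord_ne_zero hΦ hks (hp (k i))) (fun j => ?_) ha
    refine seriesIn_mono hΦ ?_ (aeval_coord_mem_seriesIn hΦ (k j) (p (k j)))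
    rw [Set.subset_compl_singleton_iff, Set.mem_insert_iff, not_or]
    refine ⟨fun h => ?_, hks⟩
    have h1 : j.1.val < i.val := j.2
    have h2 := congrArg Fin.val h
    rw [hk, hk] at h2
    omega

theorem exists_monic_aeval_mem {s : Set (Fin n)} {P : Ideal (MvPowerSeries (Fin n) K)}
    (hfin : ((Ideal.Quotient.mk P).comp (seriesIn z hz s).subtype).Finite)
    (a : MvPowerSeries (Fin n) K) :
    ∃ p : Polynomial (seriesIn z hz s), p.Monic ∧ Polynomial.aeval a p ∈ P := by
  obtain ⟨p, hp, hpa⟩ := hfin.to_isIntegral (Ideal.Quotient.mk P a)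
  refine ⟨p, hp, ?_⟩
  rw [← Polynomial.hom_eval₂, Ideal.Quotient.eq_zero_iff_mem] at hpa
  exact hpa

end Coordinates

theorem proposition2p2 (K : Type*) [Field K] (n r : ℕ) (hr : 1 ≤ r) (hrn : r < n)
    (P : Ideal (MvPowerSeries (Fin n) K)) [P.IsPrime]
    (hx : (X ⟨0, Nat.zero_lt_of_lt hrn⟩ : MvPowerSeries (Fin n) K) ∉ P)
    (hP : P.height = r) :
    -- there is a change of variables `z` involving only the variables other than the first one
    ∃ (z : Fin n → MvPowerSeries (Fin n) K)
      (hcv : IsChangeOfVariables K {i : Fin n | i.val ≠ 0} z)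
      (f : Fin r → MvPowerSeries (Fin n) K),
      let hz := hcv.constantCoeff_eq_zero
      -- index sets of the first `n - r` and of the last `r` variables
      let Z₁ : Set (Fin n) := {j | j.val < n - r}
      let Z₂ : Set (Fin n) := {j | n - r ≤ j.val}
      -- `A₁ = K[[Z₁]]`, and `D` is `K[[Z₁]][Z₂]` localized at `(Z)`
      let A₁ := seriesIn z hz Z₁
      let D := localPolyIn z hz Z₁ Z₂
      let P₁ : Ideal D := P.comap (algebraMap D (MvPowerSeries (Fin n) K))
      -- the canonical map `A₁ → D ⧸ P₁`
      let φ : A₁ →+* D ⧸ P₁ := (Ideal.Quotient.mk P₁).comp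
        (Subring.inclusion (seriesIn_le_localPolyIn z hz Z₁ Z₂))
      z ⟨0, Nat.zero_lt_of_lt hrn⟩ = X ⟨0, Nat.zero_lt_of_lt hrn⟩ ∧
      RingTheory.Sequence.IsRegular (MvPowerSeries (Fin n) K) (List.ofFn f) ∧
      (∀ i, f i ∈ P) ∧
      -- `f i` is a monic polynomial in `z_{n-1-i}` with coefficients in
      -- `K[[Z₁]][z_{n-r}, …, z_{n-2-i}]` (indices start at `0`)
      (∀ i : Fin r, ∃ g : Polynomial (polyIn z hz Z₁ {j | n - r ≤ j.val ∧ j.val < n - 1 - i.val}),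
        g.Monic ∧ Polynomial.aeval (z ⟨n - 1 - i.val, by omega⟩) g = f i) ∧
      -- (1)
      P ∈ (Ideal.span (Set.range f)).minimalPrimes ∧
      -- (2): `K[[X]] = K[[Z]]`, and it is the `(Z₂)`-adic and the `(f)`-adic completion of `D`
      Function.Injective (substHom z hz Set.univ) ∧
      seriesIn z hz Set.univ = ⊤ ∧
      Nonempty (AdicCompletion (Ideal.span {d : D | ∃ j ∈ Z₂, (d : MvPowerSeries (Fin n) K) = z j}) D
        ≃ₐ[D] MvPowerSeries (Fin n) K) ∧
      Nonempty (AdicCompletion (Ideal.span {d : D | ∃ i, (d : MvPowerSeries (Fin n) K) = f i}) D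
        ≃ₐ[D] MvPowerSeries (Fin n) K) ∧
      -- (3)
      P₁.map (algebraMap D (MvPowerSeries (Fin n) K)) = P ∧
      -- (4)
      Function.Injective φ ∧
      Function.Bijective (Ideal.quotientMap P (algebraMap D (MvPowerSeries (Fin n) K))
        (le_refl P₁)) ∧
      φ.Finite ∧
      φ.IsIntegral := by
  have hn : 0 < n := Nat.zero_lt_of_lt hrn
  have hPtop : P ≠ ⊤ := Ideal.IsPrime.ne_top ‹_›
  obtain ⟨d, hdn, z, hcv, hfin, hinj⟩ := exists_noether_normalization P hn hx
  obtain ⟨Φ, hΦ⟩ := hcv.exists_algEquiv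
  have hz := hcv.constantCoeff_eq_zero
  choose p hp hpP using fun k => exists_monic_aeval_mem hfin (z k)
  -- the dimension of `K⟦X⟧ ⧸ P` is determined by the height of `P`
  have hspan : ∀ (r' : ℕ) (k : Fin r' → Fin n), Ideal.span (Set.range fun i =>
      Polynomial.aeval (z (k i)) (p (k i))) ≤ P := fun r' k => by
    rw [Ideal.span_le]
    rintro _ ⟨i, rfl⟩
    exact hpP (k i)
  have hJ : ∀ (r' : ℕ), d + r' = n → ∀ k : Fin r' → Fin n, (∀ i, (k i).val = n - 1 - i.val) →
      ∀ j : Fin n, d ≤ j.val → Polynomial.aeval (z j) (p j) ∈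
        Ideal.span (Set.range fun i => Polynomial.aeval (z (k i)) (p (k i))) := by
    intro r' hdr k hk j hj
    refine Ideal.subset_span ⟨⟨n - 1 - j.val, by omega⟩, ?_⟩
    have : k ⟨n - 1 - j.val, by omega⟩ = j := Fin.ext (by rw [hk]; simp only; omega)
    simp only [this]
  -- The `n - d` equations form a regular sequence in `P`, bounding the height from below; `P` is
  -- minimal over them, so Krull's height theorem bounds it from above.
  have hdr : d + r = n := by
    let k : Fin (n - d) → Fin n := fun i => ⟨n - 1 - i.val, by omega⟩
    have hreg := isRegular_ofFn_aeval_coord hΦ (Nat.add_sub_cancel' hdn) p hp hPtop hpP k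
      fun i => rfl
    have h1 : ((n - d : ℕ) : ℕ∞) ≤ P.height := by
      have := le_height_of_isRegular P hreg (by
        intro x hx
        obtain ⟨i, rfl⟩ := List.mem_ofFn.mp hx
        exact hpP (k i))
      rwa [List.length_ofFn] at this
    have hmin := mem_minimalPrimes_of_forall_aeval_mem hΦ hdn p hp (hspan _ k)
      (hJ _ (Nat.add_sub_cancel' hdn) k fun i => rfl) hinj
    have h2 : P.height ≤ ((n - d : ℕ) : ℕ∞) := by
      refine (Ideal.height_le_card_of_mem_minimalPrimes_span (Set.finite_range _) hmin).trans ?_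
      have h3 := Set.ncard_image_le (f := fun i => Polynomial.aeval (z (k i)) (p (k i)))
        (Set.finite_univ (α := Fin (n - d)))
      rw [Set.image_univ, Set.ncard_univ, Nat.card_fin] at h3
      exact_mod_cast h3
    have h4 : ((n - d : ℕ) : ℕ∞) = r := by rw [← hP]; exact le_antisymm h1 h2
    have h5 : n - d = r := by exact_mod_cast h4
    omega
  obtain rfl : d = n - r := by omega
  let k : Fin r → Fin n := fun i => ⟨n - 1 - i.val, by omega⟩
  let f : Fin r → MvPowerSeries (Fin n) K := fun i => Polynomial.aeval (z (k i)) (p (k i))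
  refine ⟨z, hcv, f, ?_⟩
  intro hz' Z₁ Z₂ A₁ D P₁ φ
  have hst : Z₁ = Z₂ᶜ := by
    ext j
    exact (not_le (a := n - r) (b := j.val)).symm
  have hfP : ∀ i, f i ∈ P := fun i => hpP (k i)
  have hfJ := hJ r hdr k fun i => rfl
  have hdiv : ∀ a, ∃ b ∈ D, a - b ∈ Ideal.span (Set.range f) := fun a => by
    obtain ⟨b, hb, hab⟩ := exists_sub_mem_of_forall_aeval_mem hΦ hdn p hp hfJ a
    exact ⟨b, polyIn_le_localPolyIn z hz Z₁ Z₂ hb, hab⟩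
  have hfD : ∀ i, f i ∈ D := fun i => by
    refine polyIn_le_localPolyIn z hz Z₁ Z₂ ?_
    simp only [f]
    rw [Polynomial.aeval_eq_sum_range]
    refine sum_mem fun j _ => ?_
    rw [Algebra.smul_def]
    have hki : z (k i) ∈ polyIn z hz Z₁ Z₂ :=
      Subring.subset_closure (Or.inr ⟨k i, show n - r ≤ n - 1 - i.val by omega, rfl⟩)
    exact mul_mem (seriesIn_le_polyIn z hz _ _ ((p (k i)).coeff j).2) (pow_mem hki j)
  have hf0 : ∀ i, constantCoeff (f i) = 0 := fun i => by
    by_contra h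
    exact hPtop (Ideal.eq_top_of_isUnit_mem _ (hfP i)
      (isUnit_iff_constantCoeff.mpr (Ne.isUnit h)))
  have hbij : Function.Bijective (Ideal.quotientMap P (algebraMap D (MvPowerSeries (Fin n) K))
      (le_refl P₁)) := by
    refine ⟨Ideal.quotientMap_injective, fun y => ?_⟩
    obtain ⟨a, rfl⟩ := Ideal.Quotient.mk_surjective y
    obtain ⟨b, hb, hab⟩ := hdiv a
    refine ⟨Ideal.Quotient.mk _ ⟨b, hb⟩, ?_⟩
    rw [Ideal.quotientMap_mk]
    exact (Ideal.Quotient.eq.mpr (hspan r k hab)).symm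
  -- Transfer finiteness from `K[[X]]/P` to `D ⧸ P₁` along the inverse of the bijection.
  have hφ : φ.Finite := by
    let e := RingEquiv.ofBijective _ hbij
    have h1 : φ = e.symm.toRingHom.comp ((Ideal.Quotient.mk P).comp A₁.subtype) := by
      ext a
      refine e.injective ?_
      exact (e.apply_symm_apply (Ideal.Quotient.mk P (a : MvPowerSeries (Fin n) K))).symm
    rw [h1]
    exact (RingHom.Finite.of_surjective _ e.symm.surjective).comp hfin
  refine ⟨hcv.eq_X (by simp), ?_, hfP, fun i => ?_, ?_, substHom_univ_injective hΦ,
    seriesIn_univ hΦ, nonempty_adicCompletion_coord_algEquiv hΦ hst,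
    nonempty_adicCompletion_span_algEquiv hΦ hst hf0 hfD hdiv, ?_, ?_, hbij, hφ,
    hφ.to_isIntegral⟩
  · exact isRegular_ofFn_aeval_coord hΦ hdr p hp hPtop hpP k fun i => rfl
  -- The equation already has its coefficients in `K[[Z₁]]`, a smaller ring than required.
  · refine ⟨(p (k i)).map (Subring.inclusion (seriesIn_le_polyIn z hz _ _)), (hp (k i)).map _, ?_⟩
    rw [Polynomial.aeval_def, Polynomial.eval₂_map]
    rfl
  · exact mem_minimalPrimes_of_forall_aeval_mem hΦ hdn p hp (hspan r k) hfJ hinj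
  -- Write `a = (a - b) + b` with `b ∈ D` and `a - b ∈ (f) ⊆ P`; then `b ∈ P₁`, and the `f i`
  -- themselves belong to `P₁`.
  · refine le_antisymm Ideal.map_comap_le fun a ha => ?_
    obtain ⟨b, hb, hab⟩ := hdiv a
    have hfle : Ideal.span (Set.range f) ≤ P₁.map (algebraMap D (MvPowerSeries (Fin n) K)) := by
      rw [Ideal.span_le]
      rintro _ ⟨i, rfl⟩
      exact Ideal.mem_map_of_mem (algebraMap D (MvPowerSeries (Fin n) K))
        (show (⟨f i, hfD i⟩ : D) ∈ P₁ from hfP i)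
    have hbP : b ∈ P := by
      have := sub_mem ha (hspan r k hab)
      rwa [sub_sub_cancel] at this
    have := add_mem (hfle hab) (Ideal.mem_map_of_mem (algebraMap D (MvPowerSeries (Fin n) K))
        (show (⟨b, hb⟩ : D) ∈ P₁ from hbP))
    exact (sub_add_cancel a b) ▸ this
  · rw [injective_iff_map_eq_zero]
    intro a ha
    have haP := Ideal.Quotient.eq_zero_iff_mem.mp
      (show Ideal.Quotient.mk P₁ (Subring.inclusion (seriesIn_le_localPolyIn z hz' Z₁ Z₂) a) = 0
        from ha)
    exact Subtype.ext (hinj a a.2 haP)
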